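/- **Conventions.** Let $\mathcal N$ be a von Neumann algebra. A *W\*-correspondence* over $\mathcal N$ is a self-dual right Hilbert C\*-module $\mathcal E$ over $\mathcal N$ (inner product $\langle\cdot,\cdot\rangle$ linear in the second variable) with a normal $*$-homomorphism $\varphi:\mathcal N\to\mathcal L(\mathcal E)$ into the adjointable operators; write $a\xi=\varphi(a)\xi$. The $\sigma$-topology of $\mathcal E$ is determined by the functionals $\xi\mapsto\sum_n\omega_n(\langle\eta_n,\xi\rangle)$ with $\eta_n\in\mathcal E$, $\omega_n\in\mathcal N_*$, $\sum_n\|\omega_n\|\|\eta_n\|<\infty$. A *completely contractive covariant representation* of $\mathcal E$ on a Hilbert space $H$ is a pair $(T,\sigma)$ of a normal $*$-representation $\sigma:\mathcal N\to B(H)$ and a linear, completely contractive map $T:\mathcal E\to B(H)$, continuous from the $\sigma$-topology to the $\sigma$-weak topology, with $T(a\xi b)=\sigma(a)T(\xi)\sigma(b)$ for $a,b\in\mathcal N$, $\xi\in\mathcal E$. (Neither $\varphi$ nor $\sigma$ is assumed to be unital.) Let $\mathcal E\otimes_\sigma H$ be the Hausdorff completion of the algebraic tensor product for $\langle\xi\otimes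 h,\eta\otimes k\rangle=\langle h,\sigma(\langle\xi,\eta\rangle)k\rangle$, and let $\tilde T:\mathcal E\otimes_\sigma H\to H$ be the contraction with $\tilde T(\xi\otimes h)=T(\xi)h$. The representation $(T,\sigma)$ is *isometric* if $T(\xi)^*T(\eta)=\sigma(\langle\xi,\eta\rangle)$ for all $\xi,\eta\in\mathcal E$, and *fully coisometric* if $\tilde T\tilde T^*=I_H$. An *isometric dilation* of $(T,\sigma)$ is an isometric completely contractive covariant representation $(V,\rho)$ of $\mathcal E$ on a Hilbert space $K\supseteq H$ such that, with $P$ the projection of $K$ onto $H$, 1. $P$ commutes with $\rho(\mathcal N)$ and $\rho(a)P=\sigma(a)P$ for $a\in\mathcal N$; 2. for all $\eta\in\mathcal E$, $V(\eta)^*$ leaves $H$ invariant and $PV(\eta)P=T(\eta)P$. It is *minimal* if the smallest closed subspace of $K$ that contains $H$ and reduces $(V,\rho)$ is $K$. **Theorem.** Let $\mathcal E$ be a W\*-correspondence over a von Neumann algebra $\mathcal N$ and let $(T,\sigma)$ be a completely contractive covariant representation of $\mathcal E$ on a Hilbert space $H$. (a) (Existence.) Let $\Delta=(I-\tilde T^*\tilde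 T)^{1/2}$ on $\mathcal E\otimes_\sigma H$ and let $\mathcal D$ be the closure of its range. The operators $\varphi(a)\otimes I$, $a\in\mathcal N$, leave $\mathcal D$ invariant; let $\sigma_1$ be the resulting representation of $\mathcal N$ on $\mathcal D$, and for $n\ge1$ let $\sigma_{n+1}(a)=\varphi(a)\otimes I$ on $\mathcal E^{\otimes n}\otimes_{\sigma_1}\mathcal D=\mathcal E\otimes_{\sigma_n}(\mathcal E^{\otimes(n-1)}\otimes_{\sigma_1}\mathcal D)$, where $\mathcal E^{\otimes0}\otimes_{\sigma_1}\mathcal D=\mathcal D$. On $$K=H\oplus\mathcal D\oplus\bigoplus_{n=1}^{\infty}\mathcal E^{\otimes n}\otimes_{\sigma_1}\mathcal D$$ put $\rho=\mathrm{diag}(\sigma,\sigma_1,\sigma_2,\dots)$ and $$V(\xi)(h,d_0,d_1,d_2,\dots)=\bigl(T(\xi)h,\ \Delta(\xi\otimes h),\ \xi\otimes d_0,\ \xi\otimes d_1,\dots\bigr),\qquad \xi\in\mathcal E.$$ Then $(V,\rho)$ is a well-defined completely contractive covariant representation of $\mathcal E$ on $K$, and it is a minimal isometric dilation of $(T,\sigma)$.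 If $\varphi$ and $\sigma$ are unital, so is $\rho$. (b) (Uniqueness.) If $(V_1,\rho_1)$ on $K_1$ and $(V_2,\rho_2)$ on $K_2$ are minimal isometric dilations of $(T,\sigma)$, then there is a unitary $U:K_1\to K_2$ with $Uh=h$ for $h\in H$, $U\rho_1(a)=\rho_2(a)U$ for $a\in\mathcal N$ and $UV_1(\xi)=V_2(\xi)U$ for $\xi\in\mathcal E$. (c) If $(T,\sigma)$ is fully coisometric, then so is its minimal isometric dilation. -/

import Mathlib

/-!
Hilbert modules, correspondences, covariant representations and their dilations.
-/

noncomputable section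

namespace WCorr

open scoped InnerProductSpace TensorProduct Topology
open MulOpposite

set_option linter.unusedSectionVars false

universe u v w

/-- A C*-correspondence over a unital C*-algebra `A`: a right Hilbert `A`-module `E` (right
multiplication by `a` is `op a • x`), whose `A`-valued inner product is conjugate linear in the
first variable and induces the norm of `E`, together with a `*`-homomorphism
`lact : A → 𝓛(E)` giving the left action by adjointable operators. As in the general theory,
`lact` is not required to be unital. -/
class CStarCorrespondence (A : Type*) [CStarAlgebra A] [PartialOrder A] (E : Type*)
    [NormedAddCommGroup E] [NormedSpace ℂ E] [Module Aᵐᵒᵖ E] extends Inner A E where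
  inner_add_right (x y z : E) : inner x (y + z) = inner x y + inner x z
  inner_smul_right (c : ℂ) (x y : E) : inner x (c • y) = c • inner x y
  inner_op_smul_right (a : A) (x y : E) : inner x (op a • y) = inner x y * a
  star_inner (x y : E) : star (inner x y) = inner y x
  inner_self_nonneg (x : E) : 0 ≤ inner x x
  norm_sq_eq (x : E) : ‖x‖ ^ 2 = ‖inner x x‖
  lact : A →ₙₐ[ℂ] (E →L[ℂ] E)
  inner_lact_left (a : A) (x y : E) : inner (lact a x) y = inner x (lact (star a) y)

section Basics

variable {A : Type*} [CStarAlgebra A] [PartialOrder A]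
  {E : Type*} [NormedAddCommGroup E] [NormedSpace ℂ E] [Module Aᵐᵒᵖ E] [CStarCorrespondence A E]

lemma inner_add_left' (x y z : E) : inner A (x + y) z = inner A x z + inner A y z := by
  rw [← CStarCorrespondence.star_inner z (x + y), CStarCorrespondence.inner_add_right, star_add,
    CStarCorrespondence.star_inner, CStarCorrespondence.star_inner]

lemma inner_smul_left' (c : ℂ) (x y : E) : inner A (c • x) y = star c • inner A x y := by
  rw [← CStarCorrespondence.star_inner y (c • x), CStarCorrespondence.inner_smul_right, star_smul,
    CStarCorrespondence.star_inner]

lemma inner_op_smul_left' (a : A) (x y : E) :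
    inner A (op a • x) y = star a * inner A x y := by
  rw [← CStarCorrespondence.star_inner y (op a • x), CStarCorrespondence.inner_op_smul_right,
    star_mul, CStarCorrespondence.star_inner]

lemma inner_zero_right' (x : E) : inner A x (0 : E) = 0 := by
  simpa using CStarCorrespondence.inner_smul_right (A := A) 0 x (0 : E)

lemma inner_zero_left' (x : E) : inner A (0 : E) x = 0 := by
  simpa using inner_smul_left' (A := A) 0 (0 : E) x

lemma inner_sum_right' {ι : Type*} (s : Finset ι) (x : E) (y : ι → E) :
    inner A x (∑ i ∈ s, y i) = ∑ i ∈ s, inner A x (y i) := by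
  classical
  induction s using Finset.induction_on with
  | empty => simp [inner_zero_right']
  | insert a s ha ih =>
    rw [Finset.sum_insert ha, Finset.sum_insert ha, CStarCorrespondence.inner_add_right, ih]

lemma inner_sum_left' {ι : Type*} (s : Finset ι) (x : E) (y : ι → E) :
    inner A (∑ i ∈ s, y i) x = ∑ i ∈ s, inner A (y i) x := by
  rw [← CStarCorrespondence.star_inner, inner_sum_right', star_sum]
  simp only [CStarCorrespondence.star_inner]

end Basics

/-! ### Positivity in matrix algebras -/

section Abstract

variable {A : Type*} [CStarAlgebra A]

lemma exists_neg_part (m : A) (hsa : IsSelfAdjoint m) :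
    ∃ b d : A, star b = b ∧ b * m * b = -(star d * d) ∧ (d = 0 → ∃ c, m = star c * c) := by
  let _ := CStarAlgebra.spectralOrder A
  let _ := CStarAlgebra.spectralOrderedRing A
  have hb : star (m⁻) = m⁻ := (CFC.negPart_nonneg m).isSelfAdjoint
  have hcube : 0 ≤ m⁻ * m⁻ * m⁻ := by
    have := star_left_conjugate_nonneg (CFC.negPart_nonneg m) (m⁻)
    rwa [hb] at this
  obtain ⟨d, hd⟩ := CStarAlgebra.nonneg_iff_eq_star_mul_self.mp hcube
  refine ⟨m⁻, d, hb, ?_, fun h0 => ?_⟩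
  · have : m⁻ * m * m⁻ = m⁻ * (m⁺ - m⁻) * m⁻ := by rw [CFC.posPart_sub_negPart m hsa]
    rw [this, mul_sub, CFC.negPart_mul_posPart, ← hd]
    simp
  · have hz : m⁻ * m⁻ * m⁻ = 0 := by rw [hd, h0, mul_zero]
    have h1 : m⁻ * m⁻ = 0 := by
      apply (CStarRing.star_mul_self_eq_zero_iff _).mp
      rw [star_mul, hb, ← mul_assoc, hz, zero_mul]
    have h2 : m⁻ = 0 := by
      apply (CStarRing.star_mul_self_eq_zero_iff _).mp
      rw [hb, h1]
    apply CStarAlgebra.nonneg_iff_eq_star_mul_self.mp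
    rw [← CFC.posPart_sub_negPart m hsa, h2, sub_zero]
    exact CFC.posPart_nonneg m

lemma rep_star_mul {H : Type*} [NormedAddCommGroup H] [InnerProductSpace ℂ H] [CompleteSpace H]
    (σ : A →⋆ₙₐ[ℂ] (H →L[ℂ] H)) (a b : A) (h k : H) :
    ⟪h, σ (star a * b) k⟫_ℂ = ⟪σ a h, σ b k⟫_ℂ := by
  rw [map_mul, map_star, ContinuousLinearMap.star_eq_adjoint,
    FunLike.coe_mul_eq_comp, Function.comp_apply, ContinuousLinearMap.adjoint_inner_right]

lemma adjoint_rep {H : Type*} [NormedAddCommGroup H] [InnerProductSpace ℂ H] [CompleteSpace H]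
    (σ : A →⋆ₙₐ[ℂ] (H →L[ℂ] H)) (a : A) : ContinuousLinearMap.adjoint (σ (star a)) = σ a := by
  rw [← ContinuousLinearMap.star_eq_adjoint, ← map_star, star_star]

lemma rep_form {H : Type*} [NormedAddCommGroup H] [InnerProductSpace ℂ H] [CompleteSpace H]
    (σ : A →⋆ₙₐ[ℂ] (H →L[ℂ] H)) {n : ℕ} (c : CStarMatrix (Fin n) (Fin n) A) (h : Fin n → H) :
    ∑ i, ∑ j, ⟪h i, σ ((star c * c) i j) (h j)⟫_ℂ
      = ∑ k, ⟪∑ i, σ (c k i) (h i), ∑ i, σ (c k i) (h i)⟫_ℂ := by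
  have h1 : ∀ i j, (star c * c) i j = ∑ k, star (c k i) * c k j := fun i j => rfl
  simp only [h1, sum_inner, inner_sum, map_sum, sum_apply, rep_star_mul]
  rw [Finset.sum_comm]
  refine (Finset.sum_congr rfl fun j _ => Finset.sum_comm).trans ?_
  rw [Finset.sum_comm]

lemma exists_sqrt (g c : A) (hg : g = star c * c) {ε : ℝ} (hε : 0 < ε) :
    ∃ s t : A, star t = t ∧ t * s = 1 ∧ star s * s = g + (ε : ℂ) • 1 ∧ ‖t * g * t‖ ≤ 1 := by
  let _ := CStarAlgebra.spectralOrder A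
  let _ := CStarAlgebra.spectralOrderedRing A
  have hg0 : 0 ≤ g := hg ▸ star_mul_self_nonneg c
  have he : (ε : ℂ) • (1 : A) = algebraMap ℝ A ε := by
    rw [Algebra.algebraMap_eq_smul_one]; exact Complex.coe_smul ε 1
  have he0 : IsStrictlyPositive ((ε : ℂ) • (1 : A)) := by
    rw [he]
    exact isStrictlyPositive_algebraMap hε
  have hpos : IsStrictlyPositive (g + (ε : ℂ) • 1) := he0.nonneg_add hg0
  have hs : IsStrictlyPositive (CFC.sqrt (g + (ε : ℂ) • 1)) := hpos.sqrt
  have hsa : star (CFC.sqrt (g + (ε : ℂ) • 1)) = CFC.sqrt (g + (ε : ℂ) • 1) :=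
    (CFC.sqrt_nonneg _).isSelfAdjoint
  obtain ⟨u, hu⟩ := hs.isUnit
  have hut : star (↑u⁻¹ : A) = ↑u⁻¹ := by
    rw [← Units.coe_star, star_inv]
    congr 2
    ext
    rw [Units.coe_star, hu, hsa]
  have hss : CFC.sqrt (g + (ε : ℂ) • 1) * CFC.sqrt (g + (ε : ℂ) • 1) = g + (ε : ℂ) • 1 :=
    CFC.sqrt_mul_sqrt_self _ hpos.nonneg
  refine ⟨u, ↑u⁻¹, hut, by simp, by rw [hu, hsa, hss], ?_⟩
  have h1 : (↑u⁻¹ : A) * g * ↑u⁻¹ ≤ 1 := by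
    have : (↑u⁻¹ : A) * g * ↑u⁻¹ ≤ ↑u⁻¹ * (g + (ε : ℂ) • 1) * ↑u⁻¹ := by
      have := star_left_conjugate_le_conjugate
        (show g ≤ g + (ε : ℂ) • 1 from le_add_of_nonneg_right he0.nonneg) (↑u⁻¹ : A)
      rwa [hut] at this
    refine this.trans_eq ?_
    rw [← hss, ← hu]
    simp
  have h0 : 0 ≤ (↑u⁻¹ : A) * g * ↑u⁻¹ := by
    have := star_left_conjugate_nonneg hg0 (↑u⁻¹ : A)
    rwa [hut] at this
  exact (CStarAlgebra.norm_le_one_iff_of_nonneg _ h0).mpr h1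

lemma exists_compl (m : A) (hm : ‖m‖ ≤ 1) : ∃ c : A, 1 - star m * m = star c * c := by
  let _ := CStarAlgebra.spectralOrder A
  let _ := CStarAlgebra.spectralOrderedRing A
  apply CStarAlgebra.nonneg_iff_eq_star_mul_self.mp
  rw [sub_nonneg]
  refine (CStarAlgebra.norm_le_one_iff_of_nonneg _ (star_mul_self_nonneg m)).mp ?_
  rw [CStarRing.norm_star_mul_self]
  nlinarith [norm_nonneg m]

lemma exists_shift (a : A) :
    ∃ d : A, star d = d ∧ star a * a = ((2 * ‖a‖ : ℝ) : ℂ) • d - d * d := by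
  let _ := CStarAlgebra.spectralOrder A
  let _ := CStarAlgebra.spectralOrderedRing A
  have h0 : 0 ≤ algebraMap ℝ A (‖a‖ ^ 2) - star a * a := by
    rw [sub_nonneg, sq, ← CStarRing.norm_star_mul_self]
    exact IsSelfAdjoint.le_algebraMap_norm_self (IsSelfAdjoint.star_mul_self a)
  have hs : star (CFC.sqrt (algebraMap ℝ A (‖a‖ ^ 2) - star a * a)) = _ :=
    (CFC.sqrt_nonneg _).isSelfAdjoint
  have hss := CFC.sqrt_mul_sqrt_self _ h0
  set s := CFC.sqrt (algebraMap ℝ A (‖a‖ ^ 2) - star a * a)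
  refine ⟨algebraMap ℝ A ‖a‖ - s, ?_, ?_⟩
  · rw [star_sub, hs]
    congr 1
    exact (IsSelfAdjoint.algebraMap A (IsSelfAdjoint.all _)).star_eq
  · have h2 : star a * a = algebraMap ℝ A (‖a‖ ^ 2) - s * s := by rw [hss]; abel
    rw [h2, Complex.coe_smul]
    simp only [Algebra.algebraMap_eq_smul_one, sub_mul, mul_sub, smul_mul_assoc, one_mul,
      mul_smul_comm, mul_one, smul_sub, smul_smul, sq]
    module

end Abstract

section Gram

variable {A : Type*} [CStarAlgebra A] [PartialOrder A] [StarOrderedRing A]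

lemma matrix_eq_zero {n : ℕ} (d : CStarMatrix (Fin n) (Fin n) A)
    (h : ∀ k, (star d * d) k k ≤ 0) : d = 0 := by
  ext i k
  have h1 : (star d * d) k k = ∑ i, star (d i k) * d i k := rfl
  have h2 : ∑ i, star (d i k) * d i k = 0 :=
    le_antisymm (h1 ▸ h k) (Finset.sum_nonneg fun i _ => star_mul_self_nonneg (d i k))
  have h3 := (Finset.sum_eq_zero_iff_of_nonneg
    (fun i _ => star_mul_self_nonneg (d i k))).mp h2 i (Finset.mem_univ i)
  simpa using (CStarRing.star_mul_self_eq_zero_iff (d i k)).mp h3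

lemma matrix_nonneg {n : ℕ} (m : CStarMatrix (Fin n) (Fin n) A) (hsa : IsSelfAdjoint m)
    (h : ∀ a : Fin n → A, 0 ≤ ∑ i, ∑ j, star (a i) * m i j * a j) : ∃ c, m = star c * c := by
  obtain ⟨b, d, hb, hmul, hc⟩ := exists_neg_part m hsa
  have hd : d = 0 := by
    refine matrix_eq_zero d fun k => ?_
    have hk : (star b * m * b) k k = ∑ i, ∑ j, star (b i k) * m i j * b j k := by
      rw [CStarMatrix.mul_apply, Finset.sum_comm]
      refine Finset.sum_congr rfl fun j _ => ?_
      rw [CStarMatrix.mul_apply, Finset.sum_mul]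
      rfl
    have := h fun i => b i k
    rw [← hk, hb, hmul] at this
    exact neg_nonneg.mp this
  exact hc hd

variable {E : Type*} [NormedAddCommGroup E] [NormedSpace ℂ E] [Module Aᵐᵒᵖ E]
  [CStarCorrespondence A E]

/-- The Gram matrix `(⟨x i, x j⟩)` in `Mₙ(A)`. -/
def gram (A : Type*) [CStarAlgebra A] [PartialOrder A]
    {E : Type*} [NormedAddCommGroup E] [NormedSpace ℂ E] [Module Aᵐᵒᵖ E]
    [CStarCorrespondence A E] {n : ℕ} (x : Fin n → E) : CStarMatrix (Fin n) (Fin n) A :=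
  CStarMatrix.ofMatrix fun i j => inner A (x i) (x j)

lemma gram_nonneg {n : ℕ} (x : Fin n → E) : ∃ c, gram A x = star c * c := by
  refine matrix_nonneg _ ?_ fun a => ?_
  · ext i j
    exact CStarCorrespondence.star_inner _ _
  · have := CStarCorrespondence.inner_self_nonneg (A := A) (∑ i, op (a i) • x i)
    rw [inner_sum_left'] at this
    simp only [inner_sum_right', inner_op_smul_left', CStarCorrespondence.inner_op_smul_right] at this
    refine this.trans_eq (Finset.sum_congr rfl fun i _ => Finset.sum_congr rfl fun j _ => ?_)
    rfl

end Gram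

/-! ### The interior tensor product -/

section Interior

variable {A : Type*} [CStarAlgebra A] [PartialOrder A] [StarOrderedRing A]
  (E : Type*) [NormedAddCommGroup E] [NormedSpace ℂ E] [Module Aᵐᵒᵖ E] [CStarCorrespondence A E]
  {H : Type*} [NormedAddCommGroup H] [InnerProductSpace ℂ H] [CompleteSpace H]
  (σ : A →⋆ₙₐ[ℂ] (H →L[ℂ] H))

set_option linter.unusedVariables false in
/-- The algebraic tensor product `E ⊗ H`, carrying the pre-inner product
`⟨x ⊗ h, y ⊗ k⟩ = ⟨h, σ(⟨x, y⟩) k⟩`. -/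
@[nolint unusedArguments]
def PreInterior (σ : A →⋆ₙₐ[ℂ] (H →L[ℂ] H)) : Type _ := E ⊗[ℂ] H

instance : AddCommGroup (PreInterior E σ) := inferInstanceAs (AddCommGroup (E ⊗[ℂ] H))
instance : Module ℂ (PreInterior E σ) := inferInstanceAs (Module ℂ (E ⊗[ℂ] H))

/-- The sesquilinear form determined by `⟨x ⊗ h, y ⊗ k⟩ = ⟨h, σ(⟨x, y⟩) k⟩`. -/
def interiorForm : (E ⊗[ℂ] H) →ₗ⋆[ℂ] (E ⊗[ℂ] H) →ₗ[ℂ] ℂ :=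
  TensorProduct.lift <| LinearMap.mk₂'ₛₗ (starRingEnd ℂ) (starRingEnd ℂ)
    (fun x h => TensorProduct.lift <| LinearMap.mk₂ ℂ (fun y k => ⟪h, σ (inner A x y) k⟫_ℂ)
      (fun y y' k => by
        rw [CStarCorrespondence.inner_add_right, map_add, add_apply, inner_add_right])
      (fun c y k => by
        rw [CStarCorrespondence.inner_smul_right, map_smul, smul_apply, inner_smul_right,
          smul_eq_mul])
      (fun y k k' => by rw [map_add, inner_add_right])
      (fun c y k => by rw [map_smul, inner_smul_right, smul_eq_mul]))
    (fun x x' h => by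
      refine TensorProduct.ext' fun y k => ?_
      simp [inner_add_left'])
    (fun c x h => by
      refine TensorProduct.ext' fun y k => ?_
      simp [inner_smul_left', mul_comm])
    (fun x h h' => by
      refine TensorProduct.ext' fun y k => ?_
      simp)
    (fun c x h => by
      refine TensorProduct.ext' fun y k => ?_
      simp [mul_comm])

@[simp] lemma interiorForm_tmul (x y : E) (h k : H) :
    interiorForm E σ (x ⊗ₜ h) (y ⊗ₜ k) = ⟪h, σ (inner A x y) k⟫_ℂ := rfl

lemma interiorForm_sum {n : ℕ} (x : Fin n → E) (h : Fin n → H) :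
    interiorForm E σ (∑ i, x i ⊗ₜ h i) (∑ i, x i ⊗ₜ h i)
      = ∑ i, ∑ j, ⟪h i, σ (gram A x i j) (h j)⟫_ℂ := by
  simp only [map_sum, LinearMap.sum_apply, interiorForm_tmul]
  rw [Finset.sum_comm]
  rfl

lemma interiorForm_symm (z w : E ⊗[ℂ] H) :
    starRingEnd ℂ (interiorForm E σ w z) = interiorForm E σ z w := by
  induction z with
  | zero => simp
  | add z z' h h' => simp [h, h']
  | tmul x h =>
    induction w with
    | zero => simp
    | add w w' h h' => simp [h, h']
    | tmul y k =>
      rw [interiorForm_tmul, interiorForm_tmul, inner_conj_symm,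
        ← CStarCorrespondence.star_inner y x, map_star, ContinuousLinearMap.star_eq_adjoint,
        ContinuousLinearMap.adjoint_inner_right]

lemma rep_gram_nonneg {n : ℕ} (x : Fin n → E) (h : Fin n → H) :
    0 ≤ (∑ i, ∑ j, ⟪h i, σ (gram A x i j) (h j)⟫_ℂ).re := by
  obtain ⟨c, hc⟩ := gram_nonneg (A := A) x
  rw [hc, rep_form, Complex.re_sum]
  exact Finset.sum_nonneg fun k _ => inner_self_nonneg (𝕜 := ℂ)

lemma interiorForm_nonneg (z : E ⊗[ℂ] H) : 0 ≤ (interiorForm E σ z z).re := by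
  obtain ⟨n, x, h, rfl⟩ := TensorProduct.exists_sum_tmul_eq z
  rw [interiorForm_sum]
  exact rep_gram_nonneg E σ x h

/-- The pre-inner product on `E ⊗ H`. -/
@[reducible]
def interiorCore : PreInnerProductSpace.Core ℂ (PreInterior E σ) where
  inner z w := interiorForm E σ z w
  conj_inner_symm z w := interiorForm_symm E σ z w
  re_inner_nonneg z := interiorForm_nonneg E σ z
  add_left x y z := by
    exact LinearMap.map_add₂ (interiorForm E σ) x y z
  smul_left x y r := by
    exact LinearMap.map_smulₛₗ₂ (interiorForm E σ) r x y

instance : SeminormedAddCommGroup (PreInterior E σ) :=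
  InnerProductSpace.Core.toSeminormedAddCommGroup (c := interiorCore E σ)

instance : InnerProductSpace ℂ (PreInterior E σ) :=
  InnerProductSpace.ofCore (interiorCore E σ)

lemma preInterior_inner (z w : PreInterior E σ) : ⟪z, w⟫_ℂ = interiorForm E σ z w := rfl

/-- The Hilbert space `E ⊗_σ H`: the Hausdorff completion of the algebraic tensor product. -/
abbrev Interior : Type _ := UniformSpace.Completion (PreInterior E σ)

variable {E}

/-- The elementary tensor `x ⊗ h` in the algebraic tensor product. -/
def preTens (x : E) (h : H) : PreInterior E σ := (x ⊗ₜ[ℂ] h : E ⊗[ℂ] H)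

/-- The elementary tensor `x ⊗ h` in `E ⊗_σ H`. -/
def tens (x : E) (h : H) : Interior E σ := (preTens σ x h : Interior E σ)

lemma preInner_tens (x y : E) (h k : H) :
    ⟪preTens σ x h, preTens σ y k⟫_ℂ = ⟪h, σ (inner A x y) k⟫_ℂ := rfl

lemma inner_tens (x y : E) (h k : H) :
    ⟪tens σ x h, tens σ y k⟫_ℂ = ⟪h, σ (inner A x y) k⟫_ℂ := by
  rw [tens, tens, UniformSpace.Completion.inner_coe, preInner_tens]

variable {σ} in
lemma preInterior_induction {p : PreInterior E σ → Prop} (h0 : p 0)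
    (ht : ∀ x h, p (preTens σ x h)) (ha : ∀ z w, p z → p w → p (z + w)) (z) : p z :=
  TensorProduct.induction_on (motive := p) z h0 ht ha

/-- The left action on the algebraic tensor product. -/
def preLeft (a : A) : PreInterior E σ →ₗ[ℂ] PreInterior E σ :=
  TensorProduct.map (CStarCorrespondence.lact a : E →L[ℂ] E).toLinearMap LinearMap.id

lemma preLeft_tens (a : A) (x : E) (h : H) :
    preLeft σ a (preTens σ x h) = preTens σ (CStarCorrespondence.lact a x) h := rfl

lemma preTens_add (x y : E) (h : H) :
    preTens σ (x + y) h = preTens σ x h + preTens σ y h := TensorProduct.add_tmul x y h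

lemma preTens_smul (c : ℂ) (x : E) (h : H) :
    preTens σ (c • x) h = c • preTens σ x h := rfl

lemma preLeft_add (a b : A) (z : PreInterior E σ) :
    preLeft σ (a + b) z = preLeft σ a z + preLeft σ b z := by
  induction z using preInterior_induction with
  | h0 => simp
  | ht x h => simp only [preLeft_tens, map_add, add_apply, preTens_add]
  | ha z w hz hw => simp only [map_add, hz, hw]; abel

lemma preLeft_smul (c : ℂ) (a : A) (z : PreInterior E σ) :
    preLeft σ (c • a) z = c • preLeft σ a z := by
  induction z using preInterior_induction with
  | h0 => simp
  | ht x h => simp only [preLeft_tens, map_smul, smul_apply, preTens_smul]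
  | ha z w hz hw => simp only [map_add, hz, hw, smul_add]

lemma preLeft_mul (a b : A) (z : PreInterior E σ) :
    preLeft σ (a * b) z = preLeft σ a (preLeft σ b z) := by
  induction z using preInterior_induction with
  | h0 => simp
  | ht x h => simp only [preLeft_tens, map_mul, FunLike.coe_mul_eq_comp, Function.comp_apply]
  | ha z w hz hw => simp only [map_add, hz, hw]

lemma preLeft_adj (a : A) (z w : PreInterior E σ) :
    ⟪preLeft σ a z, w⟫_ℂ = ⟪z, preLeft σ (star a) w⟫_ℂ := by
  induction z using preInterior_induction with
  | h0 => simp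
  | ht x h =>
    induction w using preInterior_induction with
    | h0 => simp
    | ht y k =>
      simp only [preLeft_tens, preInner_tens, CStarCorrespondence.inner_lact_left]
    | ha z w hz hw => simp only [map_add, inner_add_right, hz, hw]
  | ha z w hz hw => simp only [map_add, inner_add_left, hz, hw]

lemma norm_preLeft_le (a : A) (z : PreInterior E σ) : ‖preLeft σ a z‖ ≤ ‖a‖ * ‖z‖ := by
  obtain ⟨d, hd, had⟩ := exists_shift a
  rw [← sq_le_sq₀ (by positivity) (by positivity), mul_pow]
  have h1 : 0 ≤ ‖((‖a‖ : ℝ) : ℂ) • z - preLeft σ d z‖ ^ 2 := by positivity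
  rw [norm_sub_sq (𝕜 := ℂ), norm_smul] at h1
  have h2 : ‖preLeft σ d z‖ ^ 2 = (⟪z, preLeft σ (d * d) z⟫_ℂ).re := by
    rw [← inner_self_eq_norm_sq (𝕜 := ℂ), preLeft_adj, hd, preLeft_mul]; rfl
  have h3 : ‖preLeft σ a z‖ ^ 2 = (⟪z, preLeft σ (star a * a) z⟫_ℂ).re := by
    rw [← inner_self_eq_norm_sq (𝕜 := ℂ), preLeft_adj, preLeft_mul]; rfl
  have h4 : preLeft σ (star a * a) z
      = ((2 * ‖a‖ : ℝ) : ℂ) • preLeft σ d z - preLeft σ (d * d) z := by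
    rw [eq_sub_iff_add_eq, ← preLeft_add, had, sub_add_cancel, preLeft_smul]
  rw [h4, inner_sub_right, inner_smul_right, Complex.sub_re, Complex.re_ofReal_mul, ← h2] at h3
  rw [inner_smul_left, Complex.conj_ofReal, RCLike.re_eq_complex_re, Complex.re_ofReal_mul,
    Complex.norm_real, norm_norm] at h1
  linarith [mul_pow ‖a‖ ‖z‖ 2]

/-- The left action on the algebraic tensor product, as a bounded operator. -/
def preLeftL (a : A) : PreInterior E σ →L[ℂ] PreInterior E σ :=
  (preLeft σ a).mkContinuous ‖a‖ (norm_preLeft_le σ a)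

lemma preLeftL_apply (a : A) (z : PreInterior E σ) : preLeftL σ a z = preLeft σ a z := rfl

lemma interior_ext {X : Type*} [NormedAddCommGroup X] [NormedSpace ℂ X]
    {f g : Interior E σ →L[ℂ] X} (h : ∀ z : PreInterior E σ, f z = g z) : f = g :=
  ContinuousLinearMap.ext fun z =>
    congrFun (UniformSpace.Completion.ext f.continuous g.continuous h) z

lemma completion_preLeftL_coe (a : A) (z : PreInterior E σ) :
    (preLeftL σ a).completion (z : Interior E σ) = (preLeft σ a z : PreInterior E σ) :=
  (preLeftL σ a).completion_apply_coe z

lemma completion_preLeftL_adj (a : A) (z w : Interior E σ) :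
    ⟪(preLeftL σ (star a)).completion z, w⟫_ℂ = ⟪z, (preLeftL σ a).completion w⟫_ℂ := by
  have hc := fun b : A => (preLeftL (E := E) σ b).completion.continuous
  refine UniformSpace.Completion.induction_on₂ z w (isClosed_eq ?_ ?_) fun z w => ?_
  · exact ((hc (star a)).comp continuous_fst).inner continuous_snd
  · exact continuous_fst.inner ((hc a).comp continuous_snd)
  · rw [completion_preLeftL_coe, completion_preLeftL_coe, UniformSpace.Completion.inner_coe,
      UniformSpace.Completion.inner_coe, preLeft_adj, star_star]

variable (E) in
/-- The induced representation `σ^E ∘ φ` of `A` on `E ⊗_σ H`, that is `a ↦ φ(a) ⊗ I`. -/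
def inducedRep : A →⋆ₙₐ[ℂ] (Interior E σ →L[ℂ] Interior E σ) where
  toFun a := (preLeftL σ a).completion
  map_smul' c a := interior_ext σ fun z => by
    rw [smul_apply, completion_preLeftL_coe, completion_preLeftL_coe, preLeft_smul,
      UniformSpace.Completion.coe_smul]; rfl
  map_zero' := interior_ext σ fun z => by
    have := preLeft_smul σ 0 0 z
    simp only [zero_smul] at this
    rw [completion_preLeftL_coe, this]; rfl
  map_add' a b := interior_ext σ fun z => by
    rw [add_apply, completion_preLeftL_coe, completion_preLeftL_coe, completion_preLeftL_coe,
      preLeft_add, UniformSpace.Completion.coe_add]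
  map_mul' a b := interior_ext σ fun z => by
    rw [FunLike.coe_mul_eq_comp, Function.comp_apply, completion_preLeftL_coe,
      completion_preLeftL_coe, completion_preLeftL_coe, preLeft_mul]
  map_star' a := (ContinuousLinearMap.eq_adjoint_iff (preLeftL σ (star a)).completion
      (preLeftL σ a).completion).mpr (completion_preLeftL_adj σ a)

lemma inducedRep_tens (a : A) (x : E) (h : H) :
    inducedRep E σ a (tens σ x h) = tens σ (CStarCorrespondence.lact a x) h :=
  (preLeftL σ a).completion_apply_coe (preTens σ x h)

end Interior

/-! ### Completely contractive covariant representations and the defect operator -/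

section Covariant

/-- A completely contractive covariant representation `(T, σ)` of a C*-correspondence on `H`,
without continuity conditions: `σ` is a `*`-representation, `T` is a bimodule map, and for all `n`
the map `(x i j) ↦ (T (x i j))` from `Mₙ(E)` to `Mₙ(B(H))` is contractive. Here `Mₙ(E)` is a Hilbert
module over `Mₙ(A)`, so `‖(x i j)‖²` is the norm of `(∑ k, ⟨x k i, x k j⟩)` in `Mₙ(A)`. -/
structure CCRep (A : Type*) [CStarAlgebra A] [PartialOrder A] [StarOrderedRing A]
    (E : Type*) [NormedAddCommGroup E] [NormedSpace ℂ E] [Module Aᵐᵒᵖ E] [CStarCorrespondence A E]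
    (H : Type*) [NormedAddCommGroup H] [InnerProductSpace ℂ H] [CompleteSpace H] where
  σ : A →⋆ₙₐ[ℂ] (H →L[ℂ] H)
  T : E →ₗ[ℂ] (H →L[ℂ] H)
  completelyContractive : ∀ (n : ℕ) (x : Fin n → Fin n → E),
    ‖CStarMatrix.ofMatrix fun i j => T (x i j)‖ ^ 2 ≤
      ‖CStarMatrix.ofMatrix fun i j => ∑ k, inner A (x k i) (x k j)‖
  map_lact : ∀ (a : A) (x : E), T (CStarCorrespondence.lact a x) = σ a * T x
  map_ract : ∀ (a : A) (x : E), T (op a • x) = T x * σ a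


variable {A : Type*} [CStarAlgebra A] [PartialOrder A] [StarOrderedRing A]
  {E : Type*} [NormedAddCommGroup E] [NormedSpace ℂ E] [Module Aᵐᵒᵖ E] [CStarCorrespondence A E]
  {H : Type*} [NormedAddCommGroup H] [InnerProductSpace ℂ H] [CompleteSpace H]

/-- The matrix with row `i₀` equal to `x` and all other rows zero. -/
def rowMat {n : ℕ} {X : Type*} [Zero X] (i₀ : Fin n) (x : Fin n → X) : Fin n → Fin n → X :=
  fun i j => if i = i₀ then x j else 0

namespace CCRep

variable (R : CCRep A E H)

lemma row_norm_le {n : ℕ} (i₀ : Fin n) (x : Fin n → E) (hx : ‖gram A x‖ ≤ 1) :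
    ‖CStarMatrix.ofMatrix fun i j => R.T (rowMat i₀ x i j)‖ ≤ 1 := by
  have h1 := R.completelyContractive n (rowMat i₀ x)
  have h2 : (CStarMatrix.ofMatrix fun i j => ∑ k, inner A (rowMat i₀ x k i) (rowMat i₀ x k j))
      = gram A x := by
    ext i j
    change ∑ k, inner A (rowMat i₀ x k i) (rowMat i₀ x k j) = inner A (x i) (x j)
    rw [Finset.sum_eq_single i₀]
    · simp [rowMat]
    · intro b _ hb
      simp [rowMat, hb, inner_zero_left']
    · simp
  rw [h2] at h1
  have h3 := h1.trans hx
  nlinarith [norm_nonneg (CStarMatrix.ofMatrix fun i j => R.T (rowMat i₀ x i j))]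

lemma contraction_form {n : ℕ} (m : CStarMatrix (Fin n) (Fin n) (H →L[ℂ] H)) (hm : ‖m‖ ≤ 1)
    (k : Fin n → H) (i₀ : Fin n) : ‖∑ j, m i₀ j (k j)‖ ^ 2 ≤ ∑ j, ‖k j‖ ^ 2 := by
  obtain ⟨c, hc⟩ := exists_compl m hm
  have h1 := rep_form (NonUnitalStarAlgHom.id ℂ (H →L[ℂ] H)) c k
  have h2 := rep_form (NonUnitalStarAlgHom.id ℂ (H →L[ℂ] H)) m k
  rw [← hc] at h1
  have h3 : ∑ i, ∑ j, ⟪k i, (NonUnitalStarAlgHom.id ℂ (H →L[ℂ] H)) ((1 - star m * m) i j) (k j)⟫_ℂ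
      = (∑ i, ⟪k i, k i⟫_ℂ) - ∑ l, ⟪∑ i, m l i (k i), ∑ i, m l i (k i)⟫_ℂ := by
    refine Eq.trans ?_ (congrArg (fun t => (∑ i, ⟪k i, k i⟫_ℂ) - t) h2)
    rw [← Finset.sum_sub_distrib]
    refine Finset.sum_congr rfl fun i _ => ?_
    have h4 : ⟪k i, k i⟫_ℂ = ∑ j, ⟪k i, (1 : CStarMatrix (Fin n) (Fin n) (H →L[ℂ] H)) i j (k j)⟫_ℂ := by
      rw [Finset.sum_eq_single i]
      · rw [CStarMatrix.one_apply_eq]; rfl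
      · intro j _ hj
        rw [CStarMatrix.one_apply_ne hj.symm]; simp
      · simp
    rw [h4, ← Finset.sum_sub_distrib]
    refine Finset.sum_congr rfl fun j _ => ?_
    rw [← inner_sub_right]
    rfl
  have h5 : 0 ≤ (∑ i, ⟪k i, k i⟫_ℂ).re - (∑ l, ⟪∑ i, m l i (k i), ∑ i, m l i (k i)⟫_ℂ).re := by
    rw [← Complex.sub_re, ← h3, h1, Complex.re_sum]
    exact Finset.sum_nonneg fun l _ => inner_self_nonneg (𝕜 := ℂ)
  rw [Complex.re_sum, Complex.re_sum] at h5
  have h6 : ∀ v : H, (⟪v, v⟫_ℂ).re = ‖v‖ ^ 2 := fun v => inner_self_eq_norm_sq (𝕜 := ℂ) v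
  simp only [h6] at h5
  refine le_trans ?_ (sub_nonneg.mp h5)
  exact Finset.single_le_sum (f := fun l => ‖∑ i, m l i (k i)‖ ^ 2)
    (fun l _ => by positivity) (Finset.mem_univ i₀)

/-- The map `x ⊗ h ↦ T x h` on the algebraic tensor product. -/
def preTilde : PreInterior E R.σ →ₗ[ℂ] H :=
  TensorProduct.lift (ContinuousLinearMap.coeLM ℂ ∘ₗ R.T)

lemma preTilde_tens (x : E) (h : H) : R.preTilde (preTens R.σ x h) = R.T x h := rfl

lemma preTilde_sum_le {n : ℕ} (x : Fin n → E) (h : Fin n → H) :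
    ‖∑ i, R.T (x i) (h i)‖ ^ 2 ≤ (∑ i, ∑ j, ⟪h i, R.σ (gram A x i j) (h j)⟫_ℂ).re := by
  obtain ⟨c, hc⟩ := gram_nonneg (A := A) x
  refine le_of_forall_pos_le_add fun δ hδ => ?_
  rcases Nat.eq_zero_or_pos n with rfl | hn
  · simpa using hδ.le
  set C : ℝ := ∑ i, (⟪h i, R.σ 1 (h i)⟫_ℂ).re with hC
  have hε : 0 < δ / (|C| + 1) := by positivity
  obtain ⟨s, t, ht, hts, hss, hn1⟩ := exists_sqrt (gram A x) c hc hε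
  let y : Fin n → E := fun j => ∑ i, op (t i j) • x i
  have hy : gram A y = t * gram A x * t := by
    have : gram A y = star t * gram A x * t := by
      ext i j
      have e1 : (star t * gram A x * t) i j
          = ∑ l, (∑ k, star (t k i) * inner A (x k) (x l)) * t l j := rfl
      rw [e1]
      change inner A (∑ k, op (t k i) • x k) (∑ l, op (t l j) • x l) = _
      simp only [inner_sum_right', inner_sum_left', CStarCorrespondence.inner_op_smul_right,
        inner_op_smul_left', Finset.sum_mul]
    rw [this, ht]
  let k : Fin n → H := fun j => ∑ l, R.σ (s j l) (h l)
  have h1 := contraction_form (CStarMatrix.ofMatrix fun i j => R.T (rowMat ⟨0, hn⟩ y i j))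
    (R.row_norm_le ⟨0, hn⟩ y (hy ▸ hn1)) k ⟨0, hn⟩
  have h2 : ∑ j, (CStarMatrix.ofMatrix fun i j => R.T (rowMat ⟨0, hn⟩ y i j)) ⟨0, hn⟩ j (k j)
      = ∑ i, R.T (x i) (h i) := by
    have e1 : ∀ j, (CStarMatrix.ofMatrix fun i j => R.T (rowMat ⟨0, hn⟩ y i j)) ⟨0, hn⟩ j (k j)
        = ∑ i, ∑ l, R.T (x i) (R.σ (t i j * s j l) (h l)) := by
      intro j
      change R.T (rowMat ⟨0, hn⟩ y ⟨0, hn⟩ j) (k j) = _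
      simp only [rowMat, if_true, y, k, map_sum, sum_apply, R.map_ract, map_mul,
        FunLike.coe_mul_eq_comp, Function.comp_apply]
      exact Finset.sum_comm
    simp only [e1]
    rw [Finset.sum_comm]
    refine Finset.sum_congr rfl fun i _ => ?_
    rw [Finset.sum_comm]
    have e2 : ∀ l, ∑ j, R.T (x i) (R.σ (t i j * s j l) (h l))
        = R.T (x i) (R.σ ((1 : CStarMatrix (Fin n) (Fin n) A) i l) (h l)) := by
      intro l
      rw [← hts, CStarMatrix.mul_apply, map_sum, sum_apply, map_sum]
    simp only [e2]
    rw [Finset.sum_eq_single i]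
    · rw [CStarMatrix.one_apply_eq]
      have := R.map_ract 1 (x i)
      rw [op_one, one_smul] at this
      conv_rhs => rw [this]
      rfl
    · intro l _ hl
      rw [CStarMatrix.one_apply_ne hl.symm]; simp
    · simp
  have h3 : ∑ j, ‖k j‖ ^ 2
      = (∑ i, ∑ j, ⟪h i, R.σ (gram A x i j) (h j)⟫_ℂ).re + δ / (|C| + 1) * C := by
    have e1 : ∑ j, ‖k j‖ ^ 2 = (∑ i, ∑ j, ⟪h i, R.σ ((star s * s) i j) (h j)⟫_ℂ).re := by
      rw [rep_form, Complex.re_sum]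
      exact Finset.sum_congr rfl fun j _ => (inner_self_eq_norm_sq (𝕜 := ℂ) (k j)).symm
    have e2 : ∀ i j, R.σ ((star s * s) i j) (h j) = R.σ (gram A x i j) (h j)
        + ((δ / (|C| + 1) : ℝ) : ℂ) • R.σ ((1 : CStarMatrix (Fin n) (Fin n) A) i j) (h j) := by
      intro i j
      rw [hss]
      change R.σ (gram A x i j + ((δ / (|C| + 1) : ℝ) : ℂ) •
        (1 : CStarMatrix (Fin n) (Fin n) A) i j) (h j) = _
      rw [map_add, map_smul]; rfl
    rw [e1]
    simp only [e2, inner_add_right, Finset.sum_add_distrib, inner_smul_right, Complex.add_re,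
      ← Finset.mul_sum]
    rw [Complex.re_ofReal_mul, hC, Complex.re_sum]
    congr 2
    rw [Complex.re_sum]
    refine Finset.sum_congr rfl fun i _ => ?_
    rw [Finset.sum_eq_single i]
    · rw [CStarMatrix.one_apply_eq]
    · intro l _ hl
      rw [CStarMatrix.one_apply_ne hl.symm]; simp
    · simp
  rw [h2, h3] at h1
  refine h1.trans ?_
  have h4 : δ / (|C| + 1) * C ≤ δ := by
    rw [div_mul_eq_mul_div, div_le_iff₀ (by positivity)]
    nlinarith [le_abs_self C]
  linarith

lemma norm_preTilde_le (z : PreInterior E R.σ) : ‖R.preTilde z‖ ≤ 1 * ‖z‖ := by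
  rw [one_mul, ← sq_le_sq₀ (by positivity) (by positivity), ← inner_self_eq_norm_sq (𝕜 := ℂ) z,
    preInterior_inner]
  obtain ⟨n, x, h, hz⟩ := TensorProduct.exists_sum_tmul_eq z
  have h1 : R.preTilde z = ∑ i, R.T (x i) (h i) := by
    rw [hz]; exact map_sum R.preTilde (fun i => preTens R.σ (x i) (h i)) Finset.univ
  rw [h1, hz, interiorForm_sum]
  exact R.preTilde_sum_le x h

/-- The contraction `T̃ : E ⊗_σ H → H` with `T̃ (x ⊗ h) = T x h`. -/
def tilde : Interior E R.σ →L[ℂ] H := (R.preTilde.mkContinuous 1 R.norm_preTilde_le).fromCompletion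

lemma tilde_tens (x : E) (h : H) : R.tilde (tens R.σ x h) = R.T x h :=
  (R.preTilde.mkContinuous 1 R.norm_preTilde_le).fromCompletion_apply_coe (preTens R.σ x h)


lemma tilde_comp_inducedRep (a : A) :
    R.tilde ∘L inducedRep E R.σ a = R.σ a ∘L R.tilde := by
  refine interior_ext R.σ fun z => ?_
  induction z using preInterior_induction with
  | h0 => rw [UniformSpace.Completion.coe_zero, map_zero, map_zero]
  | ht x h =>
    change R.tilde (inducedRep E R.σ a (tens R.σ x h)) = R.σ a (R.tilde (tens R.σ x h))
    rw [inducedRep_tens, tilde_tens, tilde_tens, R.map_lact]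
    rfl
  | ha z w hz hw => rw [UniformSpace.Completion.coe_add, map_add, map_add, hz, hw]

/-- The defect operator `Δ = (I - T̃* T̃)^(1/2)` on `E ⊗_σ H`. -/
def defectOp : Interior E R.σ →L[ℂ] Interior E R.σ :=
  CFC.sqrt (1 - ContinuousLinearMap.adjoint R.tilde ∘L R.tilde)

lemma commute_tilde (a : A) :
    Commute (1 - ContinuousLinearMap.adjoint R.tilde ∘L R.tilde) (inducedRep E R.σ a) := by
  have h1 := R.tilde_comp_inducedRep a
  have h2 := congrArg ContinuousLinearMap.adjoint (R.tilde_comp_inducedRep (star a))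
  rw [ContinuousLinearMap.adjoint_comp, ContinuousLinearMap.adjoint_comp, adjoint_rep,
    adjoint_rep] at h2
  refine (Commute.one_left _).sub_left ?_
  change (ContinuousLinearMap.adjoint R.tilde ∘L R.tilde) ∘L inducedRep E R.σ a
    = inducedRep E R.σ a ∘L (ContinuousLinearMap.adjoint R.tilde ∘L R.tilde)
  rw [ContinuousLinearMap.comp_assoc, h1, ← ContinuousLinearMap.comp_assoc, ← h2,
    ContinuousLinearMap.comp_assoc]

lemma commute_defectOp (a : A) : Commute R.defectOp (inducedRep E R.σ a) :=
  (R.commute_tilde a).cfcₙ_nnreal _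

/-- The Hilbert space `𝒟`: the closed range of the defect operator. -/
def defectSpace : Submodule ℂ (Interior E R.σ) :=
  (LinearMap.range R.defectOp.toLinearMap).topologicalClosure

instance : CompleteSpace R.defectSpace :=
  (Submodule.isClosed_topologicalClosure _).completeSpace_coe

lemma defectOp_mem (z : Interior E R.σ) : R.defectOp z ∈ R.defectSpace :=
  Submodule.le_topologicalClosure _ ⟨z, rfl⟩

lemma inducedRep_mem (a : A) {z : Interior E R.σ} (hz : z ∈ R.defectSpace) :
    inducedRep E R.σ a z ∈ R.defectSpace := by
  refine map_mem_closure (inducedRep E R.σ a).continuous hz ?_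
  rintro _ ⟨y, rfl⟩
  exact ⟨inducedRep E R.σ a y, congrArg (fun f => f y) (R.commute_defectOp a).eq⟩

/-- The restriction of `φ(a) ⊗ I` to `𝒟`. -/
def defectRestrict (a : A) : R.defectSpace →L[ℂ] R.defectSpace :=
  (inducedRep E R.σ a ∘L R.defectSpace.subtypeL).codRestrict R.defectSpace
    fun z => R.inducedRep_mem a z.2

@[simp] lemma coe_defectRestrict (a : A) (z : R.defectSpace) :
    (R.defectRestrict a z : Interior E R.σ) = inducedRep E R.σ a z := rfl

/-- The representation `σ₁` of `A` on `𝒟`, the restriction of `σ^E ∘ φ`. -/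
def defectRep : A →⋆ₙₐ[ℂ] (R.defectSpace →L[ℂ] R.defectSpace) where
  toFun := R.defectRestrict
  map_smul' c a := by ext z; simp
  map_zero' := by ext z; simp
  map_add' a b := by ext z; simp
  map_mul' a b := by ext z; simp
  map_star' a := by
    refine (ContinuousLinearMap.eq_adjoint_iff (R.defectRestrict (star a))
      (R.defectRestrict a)).mpr fun z w => ?_
    rw [Submodule.coe_inner, Submodule.coe_inner, coe_defectRestrict, coe_defectRestrict,
      ← adjoint_rep (inducedRep E R.σ) a, ContinuousLinearMap.adjoint_inner_right]

end CCRep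

end Covariant

/-! ### The space of the explicit dilation -/

/-- A Hilbert space together with a `*`-representation of `A` on it. -/
structure HilbertRep (A : Type u) [CStarAlgebra A] where
  carrier : Type v
  [normedAddCommGroup : NormedAddCommGroup carrier]
  [innerProductSpace : InnerProductSpace ℂ carrier]
  [completeSpace : CompleteSpace carrier]
  rep : A →⋆ₙₐ[ℂ] (carrier →L[ℂ] carrier)

attribute [instance] HilbertRep.normedAddCommGroup HilbertRep.innerProductSpace
  HilbertRep.completeSpace

section Model

variable {A : Type u} [CStarAlgebra A] [PartialOrder A] [StarOrderedRing A]
  {E : Type v} [NormedAddCommGroup E] [NormedSpace ℂ E] [Module Aᵐᵒᵖ E] [CStarCorrespondence A E]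
  {H : Type w} [NormedAddCommGroup H] [InnerProductSpace ℂ H] [CompleteSpace H]

namespace CCRep

variable (R : CCRep A E H)

/-- The spaces `𝒟, E ⊗ 𝒟, E ⊗ (E ⊗ 𝒟), …` with their representations `σ₁, σ₂, σ₃, …`, where
`σₙ₊₁ = σₙ^E ∘ φ` (so level `n` is `E^{⊗n} ⊗ 𝒟`, with representation `σₙ₊₁`). -/
def level : ℕ → HilbertRep.{u, max v w} A
  | 0 => ⟨R.defectSpace, R.defectRep⟩
  | n + 1 => ⟨Interior E (level n).rep, inducedRep E (level n).rep⟩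

/-- The Hilbert space `K = H ⊕ 𝒟 ⊕ (E ⊗ 𝒟) ⊕ (E^{⊗2} ⊗ 𝒟) ⊕ …`. -/
abbrev DilationSpace : Type (max v w) :=
  WithLp 2 (H × lp (fun n => (R.level n).carrier) 2)

/-- The inclusion of `H` in `K` as the first summand. -/
def incl : H →ₗᵢ[ℂ] R.DilationSpace where
  toFun h := WithLp.toLp 2 (h, 0)
  map_add' h k := by rw [← WithLp.toLp_add, Prod.mk_add_mk, add_zero]
  map_smul' c h := by rw [RingHom.id_apply, ← WithLp.toLp_smul, Prod.smul_mk, smul_zero]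
  norm_map' h := by
    change ‖WithLp.toLp 2 (h, (0 : lp (fun n => (R.level n).carrier) 2))‖ = ‖h‖
    rw [WithLp.prod_norm_eq_of_L2]
    simp

lemma incl_apply (h : H) : R.incl h = WithLp.toLp 2 (h, 0) := rfl

end CCRep
end Model


/-! ### Von Neumann algebras -/

section VonNeumann

variable {L : Type*} [NormedAddCommGroup L] [InnerProductSpace ℂ L] [CompleteSpace L]

/-- The von Neumann algebra `N ⊆ B(L)` as a C*-algebra. -/
abbrev Alg (N : VonNeumannAlgebra L) : Type _ := ↥N.toStarSubalgebra

instance isClosed_vonNeumann (N : VonNeumannAlgebra L) :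
    IsClosed (N.toStarSubalgebra : Set (L →L[ℂ] L)) := by
  have h : (N.toStarSubalgebra : Set (L →L[ℂ] L))
      = Set.centralizer (Set.centralizer (N : Set (L →L[ℂ] L))) :=
    N.centralizer_centralizer'.symm
  rw [h]
  exact Set.isClosed_centralizer _

instance starOrderedRing_vonNeumann (N : VonNeumannAlgebra L) : StarOrderedRing (Alg N) :=
  StarOrderedRing.of_nonneg_iff' (fun {x y} hxy z => by
      change (z : L →L[ℂ] L) + x ≤ z + y
      exact add_le_add_right hxy _) fun x => by
    constructor
    · intro hx
      have hx' : (0 : L →L[ℂ] L) ≤ x := hx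
      have hmem : CFC.sqrt (x : L →L[ℂ] L) ∈ N.toStarSubalgebra := by
        have h2 : ∀ b, b ∈ Set.centralizer (N : Set (L →L[ℂ] L)) →
            Commute (CFC.sqrt (x : L →L[ℂ] L)) b := fun b hb =>
          Commute.cfcₙ_nnreal (hb x x.2) _
        have h3 : CFC.sqrt (x : L →L[ℂ] L)
            ∈ Set.centralizer (Set.centralizer (N : Set (L →L[ℂ] L))) :=
          fun b hb => ((h2 b hb).eq).symm
        rwa [N.centralizer_centralizer] at h3
      refine ⟨⟨_, hmem⟩, Subtype.ext ?_⟩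
      have h4 : star (CFC.sqrt (x : L →L[ℂ] L)) = CFC.sqrt (x : L →L[ℂ] L) :=
        (CFC.sqrt_nonneg _).isSelfAdjoint
      change (x : L →L[ℂ] L) = star (CFC.sqrt (x : L →L[ℂ] L)) * CFC.sqrt (x : L →L[ℂ] L)
      rw [h4, CFC.sqrt_mul_sqrt_self _ hx']
    · rintro ⟨s, rfl⟩
      exact star_mul_self_nonneg (s : L →L[ℂ] L)

/-- The predual `N_*`: the norm closure, in the Banach space dual of `N`, of the span of the vector
functionals `a ↦ ⟨x, a y⟩`. -/
def predual (N : VonNeumannAlgebra L) : Submodule ℂ (StrongDual ℂ (Alg N)) :=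
  (Submodule.span ℂ {w | ∃ x y : L, ∀ a : Alg N, w a = ⟪x, (a : L →L[ℂ] L) y⟫_ℂ}).topologicalClosure

/-- The `σ`-weak topology of `N`: the weak topology determined by `N_*`. -/
@[reducible]
def sigmaWeak (N : VonNeumannAlgebra L) : TopologicalSpace (Alg N) :=
  ⨅ w ∈ predual N, TopologicalSpace.induced (fun a => w a) inferInstance

/-- The `σ`-weak topology of `B(H)`, determined by the functionals `a ↦ ∑ ⟨x n, a (y n)⟩` with
`∑ ‖x n‖² < ∞` and `∑ ‖y n‖² < ∞`. -/
@[reducible]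
def sigmaWeakOp (H : Type*) [NormedAddCommGroup H] [InnerProductSpace ℂ H] :
    TopologicalSpace (H →L[ℂ] H) :=
  ⨅ (x : ℕ → H) (y : ℕ → H) (_ : Summable fun n => ‖x n‖ ^ 2) (_ : Summable fun n => ‖y n‖ ^ 2),
    TopologicalSpace.induced (fun a => ∑' n, ⟪x n, a (y n)⟫_ℂ) inferInstance

/-- The `σ`-topology of a Hilbert module over `N`, determined by the functionals
`x ↦ ∑ w n (⟨y n, x⟩)` with `w n ∈ N_*` and `∑ ‖w n‖ ‖y n‖ < ∞`. -/
@[reducible]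
def sigmaTopology (N : VonNeumannAlgebra L) (E : Type*) [NormedAddCommGroup E] [NormedSpace ℂ E]
    [Module (Alg N)ᵐᵒᵖ E] [CStarCorrespondence (Alg N) E] : TopologicalSpace E :=
  ⨅ (w : ℕ → StrongDual ℂ (Alg N)) (y : ℕ → E) (_ : ∀ n, w n ∈ predual N)
    (_ : Summable fun n => ‖w n‖ * ‖y n‖),
    TopologicalSpace.induced (fun x => ∑' n, w n (inner (Alg N) (y n) x)) inferInstance

/-- A W*-correspondence over the von Neumann algebra `N`: a complete self-dual C*-correspondence whose
left action `N → 𝓛(E)` is normal, i.e. continuous from the `σ`-weak topology of `N` to the weak-*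
topology of `𝓛(E)`; the predual of `𝓛(E)` is the closed span of the functionals
`S ↦ w (⟨x, S y⟩)`, and continuity of all of these is what is required. -/
class IsWStarCorrespondence (N : VonNeumannAlgebra L) (E : Type*) [NormedAddCommGroup E]
    [NormedSpace ℂ E] [Module (Alg N)ᵐᵒᵖ E] [CStarCorrespondence (Alg N) E] : Prop where
  completeSpace : CompleteSpace E
  selfDual : ∀ Φ : E →L[ℂ] Alg N, (∀ (x : E) (a : Alg N), Φ (op a • x) = Φ x * a) →
    ∃ y : E, ∀ x, Φ x = inner (Alg N) y x
  normal : ∀ w ∈ predual N, ∀ x y : E,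
    Continuous[sigmaWeak N, inferInstance] fun a : Alg N =>
      w (inner (Alg N) x (CStarCorrespondence.lact a y))

/-- A completely contractive covariant representation `(T, σ)` of a W*-correspondence `E` over `N` on
the Hilbert space `H`: in addition `σ` is normal (`σ`-weakly continuous), and `T` is continuous from
the `σ`-topology of `E` to the `σ`-weak topology of `B(H)`. -/
structure CovRep (N : VonNeumannAlgebra L) (E : Type*) [NormedAddCommGroup E]
    [NormedSpace ℂ E] [Module (Alg N)ᵐᵒᵖ E] [CStarCorrespondence (Alg N) E]
    (H : Type*) [NormedAddCommGroup H] [InnerProductSpace ℂ H] [CompleteSpace H]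
    extends CCRep (Alg N) E H where
  normal : Continuous[sigmaWeak N, sigmaWeakOp H] σ
  continuous : Continuous[sigmaTopology N E, sigmaWeakOp H] T

open ContinuousLinearMap (adjoint)

section Dil

variable {N : VonNeumannAlgebra L} {E : Type*} [NormedAddCommGroup E]
    [NormedSpace ℂ E] [Module (Alg N)ᵐᵒᵖ E] [CStarCorrespondence (Alg N) E]
    {H : Type*} [NormedAddCommGroup H] [InnerProductSpace ℂ H] [CompleteSpace H]
    {K : Type*} [NormedAddCommGroup K] [InnerProductSpace ℂ K] [CompleteSpace K]

/-- `(T, σ)` is isometric: `T(x)* T(y) = σ(⟨x, y⟩)`. -/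
def CovRep.IsIsometric (R : CovRep N E H) : Prop :=
  ∀ x y : E, adjoint (R.T x) ∘L R.T y = R.σ (inner (Alg N) x y)

/-- `(T, σ)` is fully coisometric: `Ψ(I) = T̃ T̃* = I`, where `Ψ(S) = T̃ (S ⊗ I) T̃*`. -/
def CovRep.IsFullyCoisometric (R : CovRep N E H) : Prop :=
  R.tilde ∘L adjoint R.tilde = ContinuousLinearMap.id ℂ H

/-- For an isometric embedding `ι : H → K`, the projection `ι ι*` of `K` onto the copy of `H`. -/
def projOnto (ι : H →ₗᵢ[ℂ] K) : K →L[ℂ] K :=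
  ι.toContinuousLinearMap ∘L adjoint ι.toContinuousLinearMap

/-- `D = (V, ρ)` on `K` is an isometric dilation of `R = (T, σ)` on `H`, where `H` sits in `K` via the
isometric embedding `ι` and `P` is the projection of `K` onto `H`: `(V, ρ)` is isometric,
`P` commutes with `ρ(N)`, `ρ(a) P = σ(a) P`, each `V(x)*` leaves `H` invariant, and
`P V(x) P = T(x) P`. -/
structure IsIsometricDilation (R : CovRep N E H) (D : CovRep N E K) (ι : H →ₗᵢ[ℂ] K) : Prop where
  isometric : D.IsIsometric
  proj_comm : ∀ a : Alg N, projOnto ι ∘L D.σ a = D.σ a ∘L projOnto ι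
  rep_incl : ∀ (a : Alg N) (h : H), D.σ a (ι h) = ι (R.σ a h)
  adjoint_invariant : ∀ (x : E) (h : H), ∃ k : H, adjoint (D.T x) (ι h) = ι k
  compression : ∀ (x : E) (h : H), projOnto ι (D.T x (ι h)) = ι (R.T x h)

/-- The closed subspace `M` reduces `(V, ρ)`: it is invariant under all `ρ(a)`, `V(x)`, `V(x)*`. -/
def CovRep.Reduces (D : CovRep N E K) (M : Submodule ℂ K) : Prop :=
  IsClosed (M : Set K) ∧ (∀ a : Alg N, ∀ k ∈ M, D.σ a k ∈ M) ∧
    ∀ x : E, ∀ k ∈ M, D.T x k ∈ M ∧ adjoint (D.T x) k ∈ M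

/-- The dilation is minimal: the smallest closed subspace of `K` that contains `H` and reduces
`(V, ρ)` is `K` itself. -/
structure IsMinimalIsometricDilation (R : CovRep N E H) (D : CovRep N E K) (ι : H →ₗᵢ[ℂ] K) : Prop
    extends IsIsometricDilation R D ι where
  minimal : ∀ M : Submodule ℂ K, D.Reduces M → (∀ h, ι h ∈ M) → M = ⊤

end Dil

/-- `D = (V, ρ)` on `K = H ⊕ 𝒟 ⊕ (E ⊗ 𝒟) ⊕ …` is the explicit representation built from the
defect operator: `ρ = diag(σ, σ₁, σ₂, …)` and `Ṽ : E ⊗ K → K` has first column `(T̃, Δ, 0, 0, …)`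
and identity operators below the diagonal elsewhere, i.e.
`V(x) (h, d₀, d₁, …) = (T(x) h, Δ (x ⊗ h), x ⊗ d₀, x ⊗ d₁, …)`. -/
structure IsDefectModel {N : VonNeumannAlgebra L} {E : Type v} [NormedAddCommGroup E]
    [NormedSpace ℂ E] [Module (Alg N)ᵐᵒᵖ E] [CStarCorrespondence (Alg N) E]
    {H : Type w} [NormedAddCommGroup H] [InnerProductSpace ℂ H] [CompleteSpace H]
    (R : CovRep N E H) (D : CovRep N E R.DilationSpace) : Prop where
  rep_fst : ∀ a k, (D.σ a k).fst = R.σ a k.fst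
  rep_snd : ∀ a k n, (D.σ a k).snd n = (R.level n).rep a (k.snd n)
  T_fst : ∀ x k, (D.T x k).fst = R.T x k.fst
  T_zero : ∀ x k, (D.T x k).snd 0 = (⟨R.defectOp (tens R.σ x k.fst), R.defectOp_mem _⟩ : R.defectSpace)
  T_succ : ∀ x k n, (D.T x k).snd (n + 1) = tens (R.level n).rep x (k.snd n)

end VonNeumann

end WCorr

end

noncomputable section

namespace WCorr

open scoped InnerProductSpace TensorProduct Topology
open MulOpposite
open ContinuousLinearMap (adjoint)

set_option linter.unusedSectionVars false

/-! ### Diagonal operators on Hilbert sums -/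

section Diagonal

variable {ι : Type*} {G G' : ι → Type*} [∀ i, NormedAddCommGroup (G i)]
  [∀ i, InnerProductSpace ℂ (G i)] [∀ i, NormedAddCommGroup (G' i)]
  [∀ i, InnerProductSpace ℂ (G' i)]

/-! Existence. Since `Δ² = I - T̃* T̃`, the column `(T̃, Δ)` is isometric from `E ⊗ H` into `H ⊕ 𝒟`.
The other entries of `Ṽ` are identities carrying `E ⊗ (E^{⊗n} ⊗ 𝒟)` onto the next summand, so `V(x)*
V(y) = ρ(⟨x, y⟩)` (`CCRep.inner_modelFun`). The `H`-row of `V(x)` is `(T(x), 0, 0, …)`, so `V(x)*`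
restricts to `T(x)*` on `H`. Minimality holds because `Δ(x ⊗ h) = V(x)h - T(x)h` recovers `𝒟`, and
each further application of `V` recovers the next summand (`CCRep.eq_top_of_modelV_invariant`).

The topological conditions need more care. Normality is treated through coefficient functionals `a ↦
⟪x, π(a) y⟫`: membership in the norm-closed predual passes to direct sums, subrepresentations and
induced representations, hence to `ρ`. Complete contractivity, the right module property and
`σ`-continuity of `V` then follow from isometry (`CovRep.ofIsometric`). The continuity rests on
`continuous_inner_of_form`, which rewrites `⟪k, V(x) l⟫` as an admissible series `∑ ωₙ(⟨uₙ, x⟩)`.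

Uniqueness. In a minimal dilation the words `V(x₁) ⋯ V(xₙ) h` are total. Their inner products depend
on `(T, σ)` alone: `V(x)* V(y)` collapses to `ρ(⟨x, y⟩)`, `ρ(a)` is absorbed by the next letter, and
`V(x)*` acts on `H` as `T(x)*` (`IsIsometricDilation.inner_word`). Matching words therefore gives a
unitary, which intertwines everything.

Full coisometry. For isometric `V`, `Ṽ Ṽ*` is the projection onto the closed range of `Ṽ`, which
contains all words of positive length. If `T̃ T̃* = I`, the vector `h` is the image under `Ṽ` of
`T̃* h`, viewed in `E ⊗ K`; so the range contains `H` too, and by minimality is everything. -/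

lemma lp_norm_sq (f : lp G 2) : ‖f‖ ^ 2 = ∑' i, ‖f i‖ ^ 2 := by
  have := lp.norm_rpow_eq_tsum (p := 2) (by norm_num) f
  simpa using this

lemma lp_summable_norm_sq (f : lp G 2) : Summable fun i => ‖f i‖ ^ 2 := by
  simpa using (lp.memℓp f).summable (by norm_num)

lemma memℓp_two {f : ∀ i, G i} (hf : Summable fun i => ‖f i‖ ^ 2) : Memℓp f 2 :=
  memℓp_gen (by simpa using hf)

/-- The diagonal operator `(f i) ↦ (S i (f i))` determined by a bounded family of operators. -/
def lpDiag (S : ∀ i, G i →L[ℂ] G' i) (C : ℝ) (hS : ∀ i, ‖S i‖ ≤ C) : lp G 2 →L[ℂ] lp G' 2 :=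
  have hle : ∀ (f : lp G 2) i, ‖S i (f i)‖ ^ 2 ≤ C ^ 2 * ‖f i‖ ^ 2 := fun f i => by
    rw [← mul_pow]
    exact pow_le_pow_left₀ (norm_nonneg _) ((S i).le_of_opNorm_le (hS i) _) 2
  have hsum : ∀ f : lp G 2, Summable fun i => ‖S i (f i)‖ ^ 2 := fun f =>
    Summable.of_nonneg_of_le (fun i => by positivity) (hle f) ((lp_summable_norm_sq f).mul_left _)
  LinearMap.mkContinuous
    { toFun := fun f => ⟨fun i => S i (f i), memℓp_two (hsum f)⟩
      map_add' := fun f g => by ext i; exact map_add (S i) _ _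
      -- The absolute value is needed because `hS` does not force `0 ≤ C` when the index type is
      -- empty.
      map_smul' := fun c f => by ext i; simp } |C| fun f => by
    rw [← sq_le_sq₀ (norm_nonneg _) (by positivity), mul_pow, sq_abs, lp_norm_sq, lp_norm_sq,
      ← tsum_mul_left]
    exact (hsum f).tsum_le_tsum (hle f) ((lp_summable_norm_sq f).mul_left _)

@[simp] lemma lpDiag_apply (S : ∀ i, G i →L[ℂ] G' i) (C : ℝ) (hS : ∀ i, ‖S i‖ ≤ C) (f : lp G 2)
    (i : ι) : lpDiag S C hS f i = S i (f i) := rfl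

variable [∀ i, CompleteSpace (G i)] {A : Type*} [CStarAlgebra A]

/-- The direct sum of a family of representations. -/
def lpRep (σ : ∀ i, A →⋆ₙₐ[ℂ] (G i →L[ℂ] G i)) : A →⋆ₙₐ[ℂ] (lp G 2 →L[ℂ] lp G 2) where
  toFun a := lpDiag (fun i => σ i a) ‖a‖ fun i => NonUnitalStarAlgHom.norm_apply_le (σ i) a
  map_smul' c a := by ext f i; simp
  map_zero' := by ext f i; simp
  map_add' a b := by ext f i; simp
  map_mul' a b := by ext f i; simp
  map_star' a := by
    refine (ContinuousLinearMap.eq_adjoint_iff _ _).mpr fun f g => ?_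
    rw [lp.inner_eq_tsum, lp.inner_eq_tsum]
    refine tsum_congr fun i => ?_
    rw [lpDiag_apply, lpDiag_apply, ← adjoint_rep (σ i) a, ContinuousLinearMap.adjoint_inner_right]

@[simp] lemma lpRep_apply (σ : ∀ i, A →⋆ₙₐ[ℂ] (G i →L[ℂ] G i)) (a : A) (f : lp G 2) (i : ι) :
    lpRep σ a f i = σ i a (f i) := rfl

end Diagonal

section Product

variable {A : Type*} [CStarAlgebra A]
  {G : Type*} [NormedAddCommGroup G] [InnerProductSpace ℂ G] [CompleteSpace G]
  {G' : Type*} [NormedAddCommGroup G'] [InnerProductSpace ℂ G'] [CompleteSpace G']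

/-- The direct sum of two representations. -/
def prodRep (σ : A →⋆ₙₐ[ℂ] (G →L[ℂ] G)) (τ : A →⋆ₙₐ[ℂ] (G' →L[ℂ] G')) :
    A →⋆ₙₐ[ℂ] (WithLp 2 (G × G') →L[ℂ] WithLp 2 (G × G')) where
  toFun a := (WithLp.prodContinuousLinearEquiv 2 ℂ G G').symm.toContinuousLinearMap ∘L
    ((σ a).prodMap (τ a)) ∘L (WithLp.prodContinuousLinearEquiv 2 ℂ G G').toContinuousLinearMap
  map_smul' c a := ContinuousLinearMap.ext fun f => WithLp.ofLp_injective 2 <| Prod.ext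
    (congrArg (fun S => S f.fst) (map_smul σ c a)) (congrArg (fun S => S f.snd) (map_smul τ c a))
  map_zero' := ContinuousLinearMap.ext fun f => WithLp.ofLp_injective 2 <| Prod.ext
    (congrArg (fun S => S f.fst) (map_zero σ)) (congrArg (fun S => S f.snd) (map_zero τ))
  map_add' a b := ContinuousLinearMap.ext fun f => WithLp.ofLp_injective 2 <| Prod.ext
    (congrArg (fun S => S f.fst) (map_add σ a b)) (congrArg (fun S => S f.snd) (map_add τ a b))
  map_mul' a b := ContinuousLinearMap.ext fun f => WithLp.ofLp_injective 2 <| Prod.ext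
    (congrArg (fun S => S f.fst) (map_mul σ a b)) (congrArg (fun S => S f.snd) (map_mul τ a b))
  map_star' a := by
    refine (ContinuousLinearMap.eq_adjoint_iff _ _).mpr fun f g => ?_
    rw [WithLp.prod_inner_apply, WithLp.prod_inner_apply]
    congr 1
    · change ⟪σ (star a) f.fst, g.fst⟫_ℂ = ⟪f.fst, σ a g.fst⟫_ℂ
      rw [← adjoint_rep σ a, ContinuousLinearMap.adjoint_inner_right]
    · change ⟪τ (star a) f.snd, g.snd⟫_ℂ = ⟪f.snd, τ a g.snd⟫_ℂ
      rw [← adjoint_rep τ a, ContinuousLinearMap.adjoint_inner_right]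

end Product

/-! ### Normal representations -/

section Normal

variable {A : Type*} [CStarAlgebra A]
  {G : Type*} [NormedAddCommGroup G] [InnerProductSpace ℂ G] [CompleteSpace G]
  (π : A →⋆ₙₐ[ℂ] (G →L[ℂ] G))

/-- A representation as a bounded linear map. -/
def repCLM : A →L[ℂ] G →L[ℂ] G :=
  LinearMap.mkContinuous (π : A →ₗ[ℂ] (G →L[ℂ] G)) 1 fun a => by
    rw [one_mul]; exact NonUnitalStarAlgHom.norm_apply_le π a

/-- The functional `a ↦ ⟪x, π(a) y⟫`. -/
def coeff (x y : G) : StrongDual ℂ A := innerSL ℂ x ∘L (repCLM π).flip y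

@[simp] lemma coeff_apply (x y : G) (a : A) : coeff π x y a = ⟪x, π a y⟫_ℂ := rfl

lemma norm_coeff_le (x y : G) : ‖coeff π x y‖ ≤ ‖x‖ * ‖y‖ := by
  refine ContinuousLinearMap.opNorm_le_bound _ (by positivity) fun a => ?_
  rw [coeff_apply]
  refine (norm_inner_le_norm _ _).trans ?_
  rw [mul_assoc, mul_comm ‖y‖]
  exact mul_le_mul_of_nonneg_left
    ((π a).le_of_opNorm_le (NonUnitalStarAlgHom.norm_apply_le π a) y) (norm_nonneg x)

lemma continuous_coeff_left (y : G) : Continuous fun x => coeff π x y :=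
  (innerSL ℂ).continuous.clm_comp continuous_const

lemma continuous_coeff_right (x : G) : Continuous fun y => coeff π x y :=
  continuous_const.clm_comp (repCLM π).flip.continuous

lemma coeff_add_left (x x' y : G) : coeff π (x + x') y = coeff π x y + coeff π x' y := by
  ext a; simp

lemma coeff_add_right (x y y' : G) : coeff π x (y + y') = coeff π x y + coeff π x y' := by
  ext a; simp

lemma coeff_zero_left (y : G) : coeff π 0 y = 0 := by ext a; simp

lemma coeff_zero_right (x : G) : coeff π x 0 = 0 := by ext a; simp

variable {L : Type*} [NormedAddCommGroup L] [InnerProductSpace ℂ L] [CompleteSpace L]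
  {N : VonNeumannAlgebra L}

lemma isClosed_predual : IsClosed (predual N : Set (StrongDual ℂ (Alg N))) :=
  Submodule.isClosed_topologicalClosure _

lemma continuous_of_mem_predual {w : StrongDual ℂ (Alg N)} (hw : w ∈ predual N) :
    Continuous[sigmaWeak N, inferInstance] w :=
  continuous_iInf_dom (continuous_iInf_dom (i := hw) continuous_induced_dom)

/-- A functional continuous for the weak topology of a family of functionals lies in their linear
span, and the predual is already a subspace. -/
lemma mem_predual_of_continuous {w : StrongDual ℂ (Alg N)}
    (hw : Continuous[sigmaWeak N, inferInstance] w) : w ∈ predual N := by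
  have h1 : sigmaWeak N = ⨅ v : predual N, TopologicalSpace.induced
      ((v : StrongDual ℂ (Alg N)).toLinearMap : Alg N → ℂ) inferInstance := by
    rw [sigmaWeak, iInf_subtype']; rfl
  rw [h1] at hw
  have h2 := (LinearMap.mem_span_iff_continuous
    (f := fun v : predual N => (v : StrongDual ℂ (Alg N)).toLinearMap) w.toLinearMap).mpr hw
  have h3 : Submodule.span ℂ (Set.range fun v : predual N => (v : StrongDual ℂ (Alg N)).toLinearMap)
      ≤ (predual N).map (ContinuousLinearMap.coeLM ℂ) := by
    rw [Submodule.span_le]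
    rintro _ ⟨v, rfl⟩
    exact ⟨v, v.2, rfl⟩
  obtain ⟨v, hv, hvw⟩ := h3 h2
  have h4 : v = w := ContinuousLinearMap.coe_injective hvw
  exact h4 ▸ hv

/-- A representation of `N` is normal if its coefficient functionals lie in the predual. -/
def IsNormalRep (π : Alg N →⋆ₙₐ[ℂ] (G →L[ℂ] G)) : Prop := ∀ x y : G, coeff π x y ∈ predual N

/-- A vector functional is one of the functionals defining the `σ`-weak topology: take both
sequences supported at index `0`. -/
lemma isNormalRep_of_continuous {π : Alg N →⋆ₙₐ[ℂ] (G →L[ℂ] G)}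
    (h : Continuous[sigmaWeak N, sigmaWeakOp G] π) : IsNormalRep π := by
  intro x y
  refine mem_predual_of_continuous ?_
  have hs : ∀ z : G, Summable fun n => ‖(Pi.single 0 z : ℕ → G) n‖ ^ 2 := fun z =>
    summable_of_ne_finset_zero (s := {0}) fun n hn => by
      rw [Pi.single_eq_of_ne (by simpa using hn)]; simp
  have h1 : Continuous[sigmaWeakOp G, inferInstance]
      fun S : G →L[ℂ] G => ∑' n, ⟪(Pi.single 0 x : ℕ → G) n, S ((Pi.single 0 y : ℕ → G) n)⟫_ℂ :=
    continuous_iInf_dom (continuous_iInf_dom (continuous_iInf_dom (i := hs x)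
      (continuous_iInf_dom (i := hs y) continuous_induced_dom)))
  have h2 := @Continuous.comp _ _ _ (sigmaWeak N) (sigmaWeakOp G) _ _ _ h1 h
  convert h2 using 1
  ext a
  rw [Function.comp_apply, tsum_eq_single 0]
  · simp
  · intro n hn
    rw [Pi.single_eq_of_ne hn]; simp

/-- Coefficients are sesquilinear and norm continuous in each vector, and the predual is a
norm-closed subspace. The condition thus extends from `S` to its closed span, one variable at a
time. -/
lemma IsNormalRep.of_dense {π : Alg N →⋆ₙₐ[ℂ] (G →L[ℂ] G)} {S : Set G}
    (hS : (Submodule.span ℂ S).topologicalClosure = ⊤)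
    (h : ∀ x ∈ S, ∀ y ∈ S, coeff π x y ∈ predual N) : IsNormalRep π := by
  have key : ∀ p : G → Prop, p 0 → (∀ x y, p x → p y → p (x + y)) → (∀ (c : ℂ) x, p x → p (c • x)) →
      IsClosed {x | p x} → (∀ x ∈ S, p x) → ∀ x, p x := by
    intro p h0 ha hs hc hm x
    have h1 : (Submodule.span ℂ S : Set G) ⊆ {x | p x} := fun x hx =>
      Submodule.span_induction (p := fun x _ => p x) hm h0 (fun x y _ _ => ha x y)
        (fun c x _ => hs c x) hx
    have h2 : x ∈ (Submodule.span ℂ S).topologicalClosure := hS ▸ Submodule.mem_top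
    exact closure_minimal h1 hc h2
  have h1 : ∀ x, ∀ y ∈ S, coeff π x y ∈ predual N := by
    intro x y hy
    refine key (fun x => coeff π x y ∈ predual N) ?_ ?_ ?_ ?_ (fun x hx => h x hx y hy) x
    · rw [coeff_zero_left]; exact zero_mem _
    · intro x x' hx hx'
      rw [coeff_add_left]; exact add_mem hx hx'
    · intro c x hx
      have : coeff π (c • x) y = star c • coeff π x y := by ext a; simp [mul_comm]
      rw [this]; exact Submodule.smul_mem _ _ hx
    · exact isClosed_predual.preimage (continuous_coeff_left π y)
  intro x y
  refine key (fun y => coeff π x y ∈ predual N) ?_ ?_ ?_ ?_ (h1 x) y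
  · rw [coeff_zero_right]; exact zero_mem _
  · intro y y' hy hy'
    rw [coeff_add_right]; exact add_mem hy hy'
  · intro c y hy
    have : coeff π x (c • y) = c • coeff π x y := by ext a; simp
    rw [this]; exact Submodule.smul_mem _ _ hy
  · exact isClosed_predual.preimage (continuous_coeff_right π x)

lemma IsNormalRep.prodRep {G' : Type*} [NormedAddCommGroup G'] [InnerProductSpace ℂ G']
    [CompleteSpace G'] {π : Alg N →⋆ₙₐ[ℂ] (G →L[ℂ] G)} {τ : Alg N →⋆ₙₐ[ℂ] (G' →L[ℂ] G')}
    (hπ : IsNormalRep π) (hτ : IsNormalRep τ) : IsNormalRep (prodRep π τ) := fun x y => by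
  have : coeff (WCorr.prodRep π τ) x y = coeff π x.fst y.fst + coeff τ x.snd y.snd := by
    ext a; rfl
  rw [this]
  exact add_mem (hπ _ _) (hτ _ _)

/-- Finitely supported truncations of `g` have coefficients that are finite sums of coefficients of
the `σ i`; they converge in norm, and the predual is closed. -/
lemma IsNormalRep.lpRep {ι : Type*} {G : ι → Type*} [∀ i, NormedAddCommGroup (G i)]
    [∀ i, InnerProductSpace ℂ (G i)] [∀ i, CompleteSpace (G i)]
    {σ : ∀ i, Alg N →⋆ₙₐ[ℂ] (G i →L[ℂ] G i)} (hσ : ∀ i, IsNormalRep (σ i)) :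
    IsNormalRep (lpRep σ) := by
  classical
  intro f g
  have h1 := lp.hasSum_single (p := 2) (by norm_num) g
  refine (isClosed_predual.preimage (continuous_coeff_right (WCorr.lpRep σ) f)).mem_of_tendsto h1
    (Filter.Eventually.of_forall fun s => ?_)
  induction s using Finset.induction_on with
  | empty =>
    rw [Finset.sum_empty, Set.mem_preimage, coeff_zero_right]; exact zero_mem (predual N)
  | insert i s hi ih =>
    rw [Finset.sum_insert hi, Set.mem_preimage, coeff_add_right]
    refine add_mem (S := Submodule ℂ (StrongDual ℂ (Alg N))) ?_ ih
    have : coeff (WCorr.lpRep σ) f (lp.single 2 i (g i)) = coeff (σ i) (f i) (g i) := by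
      ext a
      rw [coeff_apply, coeff_apply]
      have h2 : WCorr.lpRep σ a (lp.single 2 i (g i)) = lp.single 2 i (σ i a (g i)) := by
        ext j
        rw [lpRep_apply]
        by_cases h : j = i
        · subst h; simp
        · rw [lp.single_apply_ne _ _ _ h, lp.single_apply_ne _ _ _ h, map_zero]
      rw [h2, lp.inner_single_right]
    rw [this]
    exact hσ i _ _

/-- The functional `a ↦ ∑ ⟪x n, π(a) (y n)⟫` is a single coefficient of the infinite ampliation of
`π`, so no separate estimate on series is needed. -/
lemma IsNormalRep.continuous {π : Alg N →⋆ₙₐ[ℂ] (G →L[ℂ] G)} (hπ : IsNormalRep π) :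
    Continuous[sigmaWeak N, sigmaWeakOp G] π := by
  refine continuous_iInf_rng.mpr fun x => continuous_iInf_rng.mpr fun y =>
    continuous_iInf_rng.mpr fun hx => continuous_iInf_rng.mpr fun hy => continuous_induced_rng.mpr ?_
  exact continuous_of_mem_predual (IsNormalRep.lpRep (fun _ : ℕ => hπ)
    (⟨x, memℓp_two hx⟩ : lp (fun _ : ℕ => G) 2) (⟨y, memℓp_two hy⟩ : lp (fun _ : ℕ => G) 2))

end Normal

/-! ### Normality of the induced representations -/

section Induced

variable {A : Type*} [CStarAlgebra A] [PartialOrder A] [StarOrderedRing A]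
  {E : Type*} [NormedAddCommGroup E] [NormedSpace ℂ E] [Module Aᵐᵒᵖ E] [CStarCorrespondence A E]
  {H : Type*} [NormedAddCommGroup H] [InnerProductSpace ℂ H] [CompleteSpace H]
  (σ : A →⋆ₙₐ[ℂ] (H →L[ℂ] H))

lemma span_tens_dense : (Submodule.span ℂ
    (Set.range fun p : E × H => tens σ p.1 p.2)).topologicalClosure = ⊤ := by
  rw [eq_top_iff]
  intro z _
  refine closure_mono ?_ (UniformSpace.Completion.denseRange_coe (α := PreInterior E σ) z)
  rintro _ ⟨w, rfl⟩
  induction w using preInterior_induction with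
  | h0 => rw [UniformSpace.Completion.coe_zero]; exact zero_mem _
  | ht x h => exact Submodule.subset_span ⟨(x, h), rfl⟩
  | ha z w hz hw => rw [UniformSpace.Completion.coe_add]; exact add_mem hz hw

/-- A closed subspace containing all elementary tensors is everything. -/
lemma mem_of_tens_mem {M : Submodule ℂ (Interior E σ)} (hM : IsClosed (M : Set (Interior E σ)))
    (h : ∀ x h, tens σ x h ∈ M) (z : Interior E σ) : z ∈ M := by
  have h1 := Submodule.topologicalClosure_minimal (Submodule.span ℂ
    (Set.range fun p : E × H => tens σ p.1 p.2)) (t := M)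
    (Submodule.span_le.mpr (by rintro _ ⟨p, rfl⟩; exact h p.1 p.2)) hM
  rw [span_tens_dense] at h1
  exact h1 Submodule.mem_top

end Induced

section InducedNormal

variable {L : Type*} [NormedAddCommGroup L] [InnerProductSpace ℂ L] [CompleteSpace L]
  {N : VonNeumannAlgebra L}
  {E : Type*} [NormedAddCommGroup E] [NormedSpace ℂ E] [Module (Alg N)ᵐᵒᵖ E]
  [CStarCorrespondence (Alg N) E] [IsWStarCorrespondence N E]
  {H : Type*} [NormedAddCommGroup H] [InnerProductSpace ℂ H] [CompleteSpace H]

/-- On elementary tensors the coefficient is `a ↦ ⟪h, σ(⟨x, φ(a) y⟩) k⟫`. This is a functional of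
the predual applied to `⟨x, φ(a) y⟩`, hence `σ`-weakly continuous by normality of the left action.
-/
lemma IsNormalRep.inducedRep {σ : Alg N →⋆ₙₐ[ℂ] (H →L[ℂ] H)} (hσ : IsNormalRep σ) :
    IsNormalRep (inducedRep E σ) := by
  refine IsNormalRep.of_dense (span_tens_dense σ) ?_
  rintro _ ⟨⟨x, h⟩, rfl⟩ _ ⟨⟨y, k⟩, rfl⟩
  refine mem_predual_of_continuous ?_
  convert IsWStarCorrespondence.normal (coeff σ h k) (hσ h k) x y using 1
  ext a
  rw [coeff_apply, inducedRep_tens, inner_tens, coeff_apply]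

lemma CovRep.isNormalRep_level (R : CovRep N E H) (n : ℕ) : IsNormalRep (R.level n).rep := by
  induction n with
  | zero =>
    intro (x : R.defectSpace) (y : R.defectSpace)
    have h1 := (isNormalRep_of_continuous R.normal).inducedRep (E := E) x y
    have h2 : coeff R.defectRep x y = coeff (WCorr.inducedRep E R.σ) x y := by ext a; rfl
    exact h2 ▸ h1
  | succ n ih => exact ih.inducedRep

end InducedNormal

/-! ### Covariant representations from isometric data -/

section Factor

variable {A : Type*} [CStarAlgebra A] [PartialOrder A] [StarOrderedRing A]
  {E : Type*} [NormedAddCommGroup E] [NormedSpace ℂ E] [Module Aᵐᵒᵖ E] [CStarCorrespondence A E]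

/-- Approximate polar decomposition in a Hilbert module. -/
lemma exists_factor (x : E) {ε : ℝ} (hε : 0 < ε) :
    ∃ (s : A) (u : E), op s • u = x ∧ ‖u‖ ≤ 1 ∧ star s * s = inner A x x + (ε : ℂ) • 1 := by
  obtain ⟨c, hc⟩ := CStarAlgebra.nonneg_iff_eq_star_mul_self.mp
    (CStarCorrespondence.inner_self_nonneg (A := A) x)
  obtain ⟨s, t, ht, hts, hss, hn⟩ := exists_sqrt (inner A x x) c hc hε
  -- Here `t` is a left inverse of `s`, so `u = x t` satisfies `u s = x`, while `⟨u, u⟩ = t ⟨x, x⟩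
  -- t` has norm at most one.
  refine ⟨s, op t • x, ?_, ?_, hss⟩
  · rw [smul_smul, ← op_mul, hts, op_one, one_smul]
  · rw [← sq_le_one_iff₀ (norm_nonneg _), CStarCorrespondence.norm_sq_eq (A := A),
      CStarCorrespondence.inner_op_smul_right, inner_op_smul_left', ht]
    exact hn

end Factor

/-! ### Automatic complete contractivity and `σ`-continuity of isometric pairs -/

section Isometric

variable {L : Type*} [NormedAddCommGroup L] [InnerProductSpace ℂ L] [CompleteSpace L]
  {N : VonNeumannAlgebra L}
  {E : Type*} [NormedAddCommGroup E] [NormedSpace ℂ E] [Module (Alg N)ᵐᵒᵖ E]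
  [CStarCorrespondence (Alg N) E]

lemma continuous_sigmaTopology {w : ℕ → StrongDual ℂ (Alg N)} {y : ℕ → E}
    (hw : ∀ n, w n ∈ predual N) (hs : Summable fun n => ‖w n‖ * ‖y n‖) :
    Continuous[sigmaTopology N E, inferInstance] fun x => ∑' n, w n (inner (Alg N) (y n) x) :=
  continuous_iInf_dom (i := w) <| continuous_iInf_dom (i := y) <| continuous_iInf_dom (i := hw) <|
    continuous_iInf_dom (i := hs) continuous_induced_dom

variable {G : Type*} [NormedAddCommGroup G] [InnerProductSpace ℂ G] [CompleteSpace G]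

/-- If `⟪W x, W y⟫ = ⟪l, π(⟨x, y⟩) l⟫` for a normal representation `π`, then the functionals
`x ↦ ⟪k, W x⟫` are continuous in the `σ`-topology. -/
lemma continuous_inner_of_form {π : Alg N →⋆ₙₐ[ℂ] (G →L[ℂ] G)} (hπ : IsNormalRep π)
    (W : E →ₗ[ℂ] G) (l : G) (hW : ∀ x y, ⟪W x, W y⟫_ℂ = ⟪l, π (inner (Alg N) x y) l⟫_ℂ) (k : G) :
    Continuous[sigmaTopology N E, inferInstance] fun x => ⟪k, W x⟫_ℂ := by
  -- Only the component of `k` in the closed range of `W` contributes.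
  obtain ⟨k', hk', k'', hk'', rfl⟩ :=
    (LinearMap.range W).topologicalClosure.exists_add_mem_mem_orthogonal k
  have h0 : ∀ x, ⟪k' + k'', W x⟫_ℂ = ⟪k', W x⟫_ℂ := fun x => by
    rw [inner_add_left, (Submodule.mem_orthogonal' _ _).mp hk'' (W x)
      (Submodule.le_topologicalClosure _ (LinearMap.mem_range_self W x)), add_zero]
  simp only [h0]
  -- Write `k'` as an absolutely convergent series of vectors `v n = W (x n)`.
  obtain ⟨v, hv, hmem, hv0, hvn⟩ := controlled_sum_of_mem_closure
    (s := (LinearMap.range W).toAddSubgroup) hk' (b := fun n => (1 / 2 : ℝ) ^ n)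
    fun n => by positivity
  choose x hx using hmem
  have hgeo : Summable fun n => (1 / 2 : ℝ) ^ n := summable_geometric_two
  have hsv : Summable fun n => ‖v n‖ := by
    -- The geometric bound `hvn` says nothing about `v 0`, so the comparison is only eventual.
    refine summable_of_isBigO_nat hgeo (Asymptotics.IsBigO.of_bound 1 ?_)
    filter_upwards [Filter.eventually_gt_atTop 0] with n hn
    rw [norm_norm, one_mul]
    exact (hvn n hn).le.trans (le_abs_self _)
  have hsum : HasSum v k' := by
    have h1 := hsv.of_norm.hasSum
    have h2 := h1.tendsto_sum_nat.comp (Filter.tendsto_add_atTop_nat 1)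
    rwa [tendsto_nhds_unique h2 hv] at h1
  -- The norms `‖x n‖` are not controlled by `‖W (x n)‖`, so the `x n` themselves need not give a
  -- summable series. Factoring `x n = u n · s n` with `‖u n‖ ≤ 1` moves the size into `π(s n) l`,
  -- whose norm is controlled by `‖v n‖`. The choice `ε = (2⁻ⁿ)²` makes the error in that norm at
  -- most `2⁻ⁿ ‖l‖`, which is summable.
  choose s u hsu hu hss using fun n =>
    exists_factor (A := Alg N) (x n) (ε := ((1 / 2 : ℝ) ^ n) ^ 2) (by positivity)
  have hform : ∀ n y, ⟪v n, W y⟫_ℂ = coeff π (π (s n) l) l (inner (Alg N) (u n) y) := by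
    intro n y
    rw [← hx n, hW, ← hsu n, inner_op_smul_left', rep_star_mul, coeff_apply]
  have hnorm : ∀ n, ‖π (s n) l‖ ≤ ‖v n‖ + (1 / 2 : ℝ) ^ n * ‖l‖ := by
    intro n
    have h1 : ‖π (s n) l‖ ^ 2
        = ‖v n‖ ^ 2 + ((1 / 2 : ℝ) ^ n) ^ 2 * (⟪l, π 1 l⟫_ℂ).re := by
      rw [← inner_self_eq_norm_sq (𝕜 := ℂ), ← inner_self_eq_norm_sq (𝕜 := ℂ) (v n), ← rep_star_mul,
        hss, map_add, map_smul, add_apply, smul_apply, inner_add_right, inner_smul_right, ← hW,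
        hx, map_add, RCLike.re_eq_complex_re, Complex.re_ofReal_mul]
    have h2 : (⟪l, π 1 l⟫_ℂ).re ≤ ‖l‖ ^ 2 := by
      refine (Complex.re_le_norm _).trans ((norm_inner_le_norm _ _).trans ?_)
      rw [sq]
      refine mul_le_mul_of_nonneg_left ?_ (norm_nonneg l)
      have h3 : ‖(1 : Alg N)‖ ≤ 1 := by
        rcases subsingleton_or_nontrivial (Alg N) with h | h
        · rw [Subsingleton.elim (1 : Alg N) 0, norm_zero]; exact zero_le_one
        · exact CStarRing.norm_one.le
      have := (π 1).le_of_opNorm_le ((NonUnitalStarAlgHom.norm_apply_le π 1).trans h3) l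
      rwa [one_mul] at this
    rw [← sq_le_sq₀ (norm_nonneg _) (by positivity), h1]
    have h4 := mul_le_mul_of_nonneg_left h2 (sq_nonneg ((1 / 2 : ℝ) ^ n))
    have h5 : 0 ≤ ‖v n‖ * ((1 / 2 : ℝ) ^ n * ‖l‖) := by positivity
    nlinarith
  have hS : Summable fun n => ‖coeff π (π (s n) l) l‖ * ‖u n‖ := by
    refine Summable.of_nonneg_of_le (fun n => by positivity) (fun n => ?_)
      ((hsv.add (hgeo.mul_right ‖l‖)).mul_right ‖l‖)
    calc ‖coeff π (π (s n) l) l‖ * ‖u n‖ ≤ ‖coeff π (π (s n) l) l‖ * 1 :=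
          mul_le_mul_of_nonneg_left (hu n) (norm_nonneg _)
      _ ≤ ‖π (s n) l‖ * ‖l‖ := by rw [mul_one]; exact norm_coeff_le _ _ _
      _ ≤ _ := mul_le_mul_of_nonneg_right (hnorm n) (norm_nonneg l)
  convert continuous_sigmaTopology (fun n => hπ (π (s n) l) l) hS using 1
  ext y
  simp only [← hform]
  have h1 : HasSum (fun n => ⟪W y, v n⟫_ℂ) ⟪W y, k'⟫_ℂ := hsum.mapL (innerSL ℂ (W y))
  have h2 := h1.mapL Complex.conjCLE.toContinuousLinearMap
  refine (HasSum.tsum_eq ?_).symm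
  simpa [inner_conj_symm] using h2

/-- An isometric pair `(V, ρ)` with `ρ` normal and `V` compatible with the left action is
automatically a completely contractive covariant representation. -/
def CovRep.ofIsometric (ρ : Alg N →⋆ₙₐ[ℂ] (G →L[ℂ] G)) (hρ : IsNormalRep ρ)
    (V : E →ₗ[ℂ] (G →L[ℂ] G)) (hV : ∀ x y, adjoint (V x) ∘L V y = ρ (inner (Alg N) x y))
    (hl : ∀ a x, V (CStarCorrespondence.lact a x) = ρ a * V x) : CovRep N E G where
  σ := ρ
  T := V
  completelyContractive n x := by
    -- The matrix `(V(x i j))` multiplied on the left by its adjoint is the entrywise image under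
    -- `ρ` of the Gram matrix, and `*`-homomorphisms of C*-algebras are contractive.
    rw [sq, ← CStarRing.norm_star_mul_self]
    have h1 : star (CStarMatrix.ofMatrix fun i j => V (x i j)) * (CStarMatrix.ofMatrix fun i j => V (x i j))
        = CStarMatrix.mapₙₐ ρ (CStarMatrix.ofMatrix fun i j =>
          ∑ k, inner (Alg N) (x k i) (x k j)) := by
      refine CStarMatrix.ext fun i j => ?_
      change ∑ k, star (V (x k i)) * V (x k j) = ρ (∑ k, inner (Alg N) (x k i) (x k j))
      rw [map_sum]
      exact Finset.sum_congr rfl fun k _ => hV _ _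
    rw [h1]
    exact NonUnitalStarAlgHom.norm_apply_le _ _
  map_lact := hl
  map_ract a x := by
    have hV' : ∀ x y, star (V x) * V y = ρ (inner (Alg N) x y) := hV
    -- With `Y = V(x a) - V(x) ρ(a)`, the four terms of `Y* Y` are values of `ρ` that cancel.
    rw [← sub_eq_zero, ← CStarRing.star_mul_self_eq_zero_iff]
    have h1 : star (V (op a • x) - V x * ρ a) * (V (op a • x) - V x * ρ a)
        = star (V (op a • x)) * V (op a • x) - star (V (op a • x)) * V x * ρ a
          - star (ρ a) * (star (V x) * V (op a • x)) + star (ρ a) * (star (V x) * V x) * ρ a := by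
      rw [star_sub, star_mul]; noncomm_ring
    rw [h1, hV', hV', hV', hV', ← map_star, ← map_mul, ← map_mul, ← map_mul, ← map_mul,
      CStarCorrespondence.inner_op_smul_right, CStarCorrespondence.inner_op_smul_right,
      inner_op_smul_left', mul_assoc]
    abel
  normal := hρ.continuous
  continuous := by
    refine continuous_iInf_rng.mpr fun k => continuous_iInf_rng.mpr fun l =>
      continuous_iInf_rng.mpr fun hk => continuous_iInf_rng.mpr fun hl =>
        continuous_induced_rng.mpr ?_
    -- In the infinite ampliation the series `∑ ⟪k n, V(x) (l n)⟫` is one inner product `⟪k', W x⟫`,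
    -- and `W` satisfies the form identity for the ampliated `ρ`.
    let k' : lp (fun _ : ℕ => G) 2 := ⟨k, memℓp_two hk⟩
    let l' : lp (fun _ : ℕ => G) 2 := ⟨l, memℓp_two hl⟩
    let W : E →ₗ[ℂ] lp (fun _ : ℕ => G) 2 :=
      { toFun := fun x => lpDiag (fun _ => V x) ‖V x‖ (fun _ => le_rfl) l'
        map_add' := fun x y => by ext n; simp
        map_smul' := fun c x => by ext n; simp }
    refine continuous_inner_of_form (IsNormalRep.lpRep fun _ : ℕ => hρ) W l' (fun x y => ?_) k'
    refine tsum_congr fun n => ?_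
    change ⟪V x (l n), V y (l n)⟫_ℂ = ⟪l n, ρ (inner (Alg N) x y) (l n)⟫_ℂ
    rw [← hV, ContinuousLinearMap.comp_apply, ContinuousLinearMap.adjoint_inner_right]

end Isometric

/-! ### The defect model -/

section ModelOperators

universe u v w

variable {A : Type u} [CStarAlgebra A] [PartialOrder A] [StarOrderedRing A]
  {E : Type v} [NormedAddCommGroup E] [NormedSpace ℂ E] [Module Aᵐᵒᵖ E] [CStarCorrespondence A E]
  {H : Type w} [NormedAddCommGroup H] [InnerProductSpace ℂ H] [CompleteSpace H]

section Tens

variable (σ : A →⋆ₙₐ[ℂ] (H →L[ℂ] H))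

lemma tens_add_right (x : E) (h k : H) : tens σ x (h + k) = tens σ x h + tens σ x k := by
  rw [tens, tens, tens, ← UniformSpace.Completion.coe_add]
  exact congrArg _ (TensorProduct.tmul_add x h k)

lemma tens_smul_right (c : ℂ) (x : E) (h : H) : tens σ x (c • h) = c • tens σ x h := by
  rw [tens, tens, ← UniformSpace.Completion.coe_smul]
  exact congrArg _ (TensorProduct.tmul_smul c x h)

lemma tens_add_left (x y : E) (h : H) : tens σ (x + y) h = tens σ x h + tens σ y h := by
  rw [tens, tens, tens, ← UniformSpace.Completion.coe_add, preTens_add]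

lemma tens_smul_left (c : ℂ) (x : E) (h : H) : tens σ (c • x) h = c • tens σ x h := by
  rw [tens, tens, ← UniformSpace.Completion.coe_smul, preTens_smul]

lemma norm_tens_le (x : E) (h : H) : ‖tens σ x h‖ ≤ ‖x‖ * ‖h‖ := by
  rw [← sq_le_sq₀ (norm_nonneg _) (by positivity), mul_pow,
    CStarCorrespondence.norm_sq_eq (A := A) x, ← inner_self_eq_norm_sq (𝕜 := ℂ), inner_tens]
  refine (Complex.re_le_norm _).trans ((norm_inner_le_norm _ _).trans ?_)
  rw [sq, mul_left_comm]
  exact mul_le_mul_of_nonneg_left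
    ((σ _).le_of_opNorm_le (NonUnitalStarAlgHom.norm_apply_le σ _) h) (norm_nonneg h)

/-- The creation operator `h ↦ x ⊗ h`. -/
def tensL (x : E) : H →L[ℂ] Interior E σ :=
  LinearMap.mkContinuous
    { toFun := tens σ x
      map_add' := tens_add_right σ x
      map_smul' := fun c h => tens_smul_right σ c x h } ‖x‖ (norm_tens_le σ x)

end Tens

namespace CCRep

variable (R : CCRep A E H)

lemma norm_tilde_le (z : Interior E R.σ) : ‖R.tilde z‖ ≤ ‖z‖ := by
  induction z using UniformSpace.Completion.induction_on with
  | hp => exact isClosed_le R.tilde.continuous.norm continuous_norm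
  | ih z =>
    have h1 : R.tilde (z : Interior E R.σ) = R.preTilde z :=
      (R.preTilde.mkContinuous 1 R.norm_preTilde_le).fromCompletion_apply_coe z
    rw [h1, UniformSpace.Completion.norm_coe, ← one_mul ‖z‖]
    exact R.norm_preTilde_le z

lemma one_sub_tilde_nonneg : 0 ≤ 1 - adjoint R.tilde ∘L R.tilde := by
  rw [ContinuousLinearMap.nonneg_iff_isPositive, ContinuousLinearMap.isPositive_def']
  constructor
  · have h1 : IsSelfAdjoint (adjoint R.tilde ∘L R.tilde) :=
      (ContinuousLinearMap.isPositive_adjoint_comp_self R.tilde).isSelfAdjoint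
    exact (IsSelfAdjoint.one _).sub h1
  · intro z
    rw [ContinuousLinearMap.reApplyInnerSelf_apply, sub_apply, inner_sub_left,
      ContinuousLinearMap.comp_apply, ContinuousLinearMap.adjoint_inner_left, map_sub, sub_nonneg,
      one_apply_eq_self, inner_self_eq_norm_sq, inner_self_eq_norm_sq]
    exact pow_le_pow_left₀ (norm_nonneg _) (R.norm_tilde_le z) 2

/-- This is `Δ* Δ = I - T̃* T̃`: the column `(T̃, Δ)` is an isometry. -/
lemma inner_defectOp (z w : Interior E R.σ) :
    ⟪R.tilde z, R.tilde w⟫_ℂ + ⟪R.defectOp z, R.defectOp w⟫_ℂ = ⟪z, w⟫_ℂ := by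
  have h1 : adjoint R.defectOp = R.defectOp := (CFC.sqrt_nonneg _).isSelfAdjoint
  have h2 : R.defectOp * R.defectOp = 1 - adjoint R.tilde ∘L R.tilde :=
    CFC.sqrt_mul_sqrt_self _ R.one_sub_tilde_nonneg
  have h3 : R.defectOp (R.defectOp w) = w - adjoint R.tilde (R.tilde w) :=
    congrArg (fun S => S w) h2
  rw [← ContinuousLinearMap.adjoint_inner_right R.defectOp, h1, h3, inner_sub_right,
    ContinuousLinearMap.adjoint_inner_right]
  ring

/-- The defect vector `Δ (x ⊗ h)` as an element of `𝒟`. -/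
def defectVec (x : E) (h : H) : R.defectSpace := ⟨R.defectOp (tens R.σ x h), R.defectOp_mem _⟩

/-- The components `Δ (x ⊗ h), x ⊗ d₀, x ⊗ d₁, …`. -/
def modelSeq (x : E) (h : H) (d : ∀ n, (R.level n).carrier) : ∀ n, (R.level n).carrier
  | 0 => R.defectVec x h
  | n + 1 => tens (R.level n).rep x (d n)

lemma modelSeq_memℓp (x : E) (h : H) (d : lp (fun n => (R.level n).carrier) 2) :
    Memℓp (R.modelSeq x h d) 2 := by
  refine memℓp_two ((summable_nat_add_iff 1).mp ?_)
  refine Summable.of_nonneg_of_le (fun n => by positivity) (fun n => ?_)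
    ((lp_summable_norm_sq d).mul_left (‖x‖ ^ 2))
  rw [← mul_pow]
  exact pow_le_pow_left₀ (norm_nonneg _) (norm_tens_le (R.level n).rep x (d n)) 2

/-- The sequence `modelSeq` as an element of the Hilbert sum. -/
def modelLp (x : E) (h : H) (d : lp (fun n => (R.level n).carrier) 2) :
    lp (fun n => (R.level n).carrier) 2 := ⟨R.modelSeq x h d, R.modelSeq_memℓp x h d⟩

/-- The representation `ρ = diag(σ, σ₁, σ₂, …)`. -/
def modelRep : A →⋆ₙₐ[ℂ] (R.DilationSpace →L[ℂ] R.DilationSpace) :=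
  prodRep R.σ (lpRep fun n => (R.level n).rep)

/-- The map `(h, d₀, d₁, …) ↦ (T(x) h, Δ (x ⊗ h), x ⊗ d₀, x ⊗ d₁, …)`. -/
def modelFun (x : E) (k : R.DilationSpace) : R.DilationSpace :=
  WithLp.toLp 2 (R.T x k.fst, R.modelLp x k.fst k.snd)

lemma dilationSpace_ext {k l : R.DilationSpace} (h1 : k.fst = l.fst) (h2 : ∀ n, k.snd n = l.snd n) :
    k = l :=
  WithLp.ofLp_injective 2 (Prod.ext h1 (lp.ext (funext h2)))

/-- The `H` and `𝒟` components together give `⟪x ⊗ h, y ⊗ h'⟫` by `inner_defectOp`. Each later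
component gives the tensor inner product of the preceding level, which supplies the shifted terms of
the sum. This yields both the boundedness of `V(x)` and the isometry of `V`. -/
lemma inner_modelFun (x y : E) (k l : R.DilationSpace) :
    ⟪R.modelFun x k, R.modelFun y l⟫_ℂ = ⟪k, R.modelRep (inner A x y) l⟫_ℂ := by
  change ⟪R.T x k.fst, R.T y l.fst⟫_ℂ + ⟪R.modelLp x k.fst k.snd, R.modelLp y l.fst l.snd⟫_ℂ
    = ⟪k.fst, R.σ (inner A x y) l.fst⟫_ℂ
      + ⟪k.snd, lpRep (fun n => (R.level n).rep) (inner A x y) l.snd⟫_ℂ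
  have h0 := (lp.summable_inner (𝕜 := ℂ) (R.modelLp x k.fst k.snd)
    (R.modelLp y l.fst l.snd)).tsum_eq_zero_add
  rw [lp.inner_eq_tsum, h0, ← add_assoc]
  refine congrArg₂ (· + ·) ?_ ?_
  · have h1 := R.inner_defectOp (tens R.σ x k.fst) (tens R.σ y l.fst)
    rw [tilde_tens, tilde_tens, inner_tens] at h1
    exact h1
  · exact tsum_congr fun n => inner_tens (R.level n).rep x y (k.snd n) (l.snd n)

lemma norm_modelFun_le (x : E) (k : R.DilationSpace) : ‖R.modelFun x k‖ ≤ ‖x‖ * ‖k‖ := by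
  rw [← sq_le_sq₀ (norm_nonneg _) (by positivity), mul_pow,
    CStarCorrespondence.norm_sq_eq (A := A) x, ← inner_self_eq_norm_sq (𝕜 := ℂ), inner_modelFun]
  refine (Complex.re_le_norm _).trans ((norm_inner_le_norm k (R.modelRep (inner A x x) k)).trans ?_)
  rw [sq, mul_left_comm]
  exact mul_le_mul_of_nonneg_left
    ((R.modelRep _).le_of_opNorm_le (NonUnitalStarAlgHom.norm_apply_le R.modelRep _) k)
    (norm_nonneg k)

lemma modelSeq_add (x : E) (h h' : H) (d d' : ∀ n, (R.level n).carrier) :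
    ∀ n, R.modelSeq x (h + h') (d + d') n = R.modelSeq x h d n + R.modelSeq x h' d' n
  | 0 => Subtype.ext (by
      change R.defectOp (tens R.σ x (h + h')) = _
      rw [tens_add_right, map_add]; rfl)
  | n + 1 => tens_add_right (R.level n).rep x (d n) (d' n)

lemma modelSeq_smul (x : E) (c : ℂ) (h : H) (d : ∀ n, (R.level n).carrier) :
    ∀ n, R.modelSeq x (c • h) (c • d) n = c • R.modelSeq x h d n
  | 0 => Subtype.ext (by
      change R.defectOp (tens R.σ x (c • h)) = _
      rw [tens_smul_right, map_smul]; rfl)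
  | n + 1 => tens_smul_right (R.level n).rep c x (d n)

lemma modelSeq_add_left (x y : E) (h : H) (d : ∀ n, (R.level n).carrier) :
    ∀ n, R.modelSeq (x + y) h d n = R.modelSeq x h d n + R.modelSeq y h d n
  | 0 => Subtype.ext (by
      change R.defectOp (tens R.σ (x + y) h) = _
      rw [tens_add_left, map_add]; rfl)
  | n + 1 => tens_add_left (R.level n).rep x y (d n)

lemma modelSeq_smul_left (c : ℂ) (x : E) (h : H) (d : ∀ n, (R.level n).carrier) :
    ∀ n, R.modelSeq (c • x) h d n = c • R.modelSeq x h d n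
  | 0 => Subtype.ext (by
      change R.defectOp (tens R.σ (c • x) h) = _
      rw [tens_smul_left, map_smul]; rfl)
  | n + 1 => tens_smul_left (R.level n).rep c x (d n)

/-- At level `0` this holds because `Δ` commutes with `φ(a) ⊗ I`; at higher levels it is how the
induced representation acts on tensors. -/
lemma modelSeq_lact (a : A) (x : E) (h : H) (d : ∀ n, (R.level n).carrier) :
    ∀ n, R.modelSeq (CStarCorrespondence.lact a x) h d n = (R.level n).rep a (R.modelSeq x h d n)
  | 0 => Subtype.ext (by
      change R.defectOp (tens R.σ (CStarCorrespondence.lact a x) h)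
        = inducedRep E R.σ a (R.defectOp (tens R.σ x h))
      rw [← inducedRep_tens]
      exact congrArg (fun S => S (tens R.σ x h)) (R.commute_defectOp a).eq)
  | n + 1 => (inducedRep_tens (R.level n).rep a x (d n)).symm

/-- The operators `V(x)` of the defect model. -/
def modelV : E →ₗ[ℂ] (R.DilationSpace →L[ℂ] R.DilationSpace) where
  toFun x := LinearMap.mkContinuous
    { toFun := R.modelFun x
      map_add' := fun _ _ => R.dilationSpace_ext (map_add (R.T x) _ _) (R.modelSeq_add x _ _ _ _)
      map_smul' := fun c _ =>
        R.dilationSpace_ext (map_smul (R.T x) c _) (R.modelSeq_smul x c _ _) }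
    ‖x‖ (R.norm_modelFun_le x)
  map_add' x y := ContinuousLinearMap.ext fun k => R.dilationSpace_ext
    (congrArg (fun S => S k.fst) (map_add R.T x y)) (R.modelSeq_add_left x y _ _)
  map_smul' c x := ContinuousLinearMap.ext fun k => R.dilationSpace_ext
    (congrArg (fun S => S k.fst) (map_smul R.T c x)) (R.modelSeq_smul_left c x _ _)

lemma modelV_isometric (x y : E) : adjoint (R.modelV x) ∘L R.modelV y = R.modelRep (inner A x y) := by
  refine ContinuousLinearMap.ext fun l => ext_inner_left ℂ fun k => ?_
  rw [ContinuousLinearMap.comp_apply, ContinuousLinearMap.adjoint_inner_right]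
  exact R.inner_modelFun x y k l

lemma modelV_lact (a : A) (x : E) :
    R.modelV (CStarCorrespondence.lact a x) = R.modelRep a * R.modelV x :=
  ContinuousLinearMap.ext fun k => R.dilationSpace_ext
    (congrArg (fun S => S k.fst) (R.map_lact a x)) (R.modelSeq_lact a x _ _)

lemma level_rep_one (hl : ∀ x : E, CStarCorrespondence.lact (1 : A) x = x) (n : ℕ) :
    (R.level n).rep 1 = ContinuousLinearMap.id ℂ _ := by
  have h1 : ∀ {G : Type (max v w)} [NormedAddCommGroup G] [InnerProductSpace ℂ G]
      [CompleteSpace G] (τ : A →⋆ₙₐ[ℂ] (G →L[ℂ] G)) (z : Interior E τ), inducedRep E τ 1 z = z :=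
    fun τ z => mem_of_tens_mem τ
      (M := LinearMap.eqLocus (inducedRep E τ 1).toLinearMap LinearMap.id)
      (isClosed_eq (inducedRep E τ 1).continuous continuous_id)
      (fun x h => (inducedRep_tens τ 1 x h).trans (by rw [hl]; rfl)) z
  cases n with
  | zero =>
    refine ContinuousLinearMap.ext fun (z : R.defectSpace) => Subtype.ext ?_
    exact mem_of_tens_mem R.σ
      (M := LinearMap.eqLocus (inducedRep E R.σ 1).toLinearMap LinearMap.id)
      (isClosed_eq (inducedRep E R.σ 1).continuous continuous_id)
      (fun x h => (inducedRep_tens R.σ 1 x h).trans (by rw [hl]; rfl)) z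
  | succ n => exact ContinuousLinearMap.ext (h1 (R.level n).rep)

lemma modelRep_one (hl : ∀ x : E, CStarCorrespondence.lact (1 : A) x = x)
    (hσ : R.σ 1 = ContinuousLinearMap.id ℂ H) :
    R.modelRep 1 = ContinuousLinearMap.id ℂ R.DilationSpace :=
  ContinuousLinearMap.ext fun k => R.dilationSpace_ext (congrArg (fun S => S k.fst) hσ)
    fun n => congrArg (fun S => S (k.snd n)) (R.level_rep_one hl n)

lemma adjoint_incl (k : R.DilationSpace) : adjoint R.incl.toContinuousLinearMap k = k.fst := by
  refine ext_inner_left ℂ fun h => ?_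
  rw [ContinuousLinearMap.adjoint_inner_right]
  change ⟪h, k.fst⟫_ℂ + ⟪(0 : lp (fun n => (R.level n).carrier) 2), k.snd⟫_ℂ = _
  rw [inner_zero_left, add_zero]

lemma projOnto_incl (k : R.DilationSpace) : projOnto R.incl k = R.incl k.fst :=
  congrArg R.incl (R.adjoint_incl k)

/-- The `H`-component of `V(x) k` depends only on the `H`-component of `k`, through `T(x)`. -/
lemma adjoint_modelV_incl (x : E) (h : H) :
    adjoint (R.modelV x) (R.incl h) = R.incl (adjoint (R.T x) h) := by
  refine ext_inner_left ℂ fun k => ?_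
  rw [ContinuousLinearMap.adjoint_inner_right]
  change ⟪R.T x k.fst, h⟫_ℂ + ⟪R.modelLp x k.fst k.snd, (0 : lp (fun n => (R.level n).carrier) 2)⟫_ℂ
    = ⟪k.fst, adjoint (R.T x) h⟫_ℂ + ⟪k.snd, (0 : lp (fun n => (R.level n).carrier) 2)⟫_ℂ
  rw [inner_zero_right, inner_zero_right, ContinuousLinearMap.adjoint_inner_right]

/-- The sequence with `n`th term `d` and all other terms zero. -/
def single (n : ℕ) (d : (R.level n).carrier) : lp (fun n => (R.level n).carrier) 2 :=
  lp.single 2 n d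

lemma single_self (n : ℕ) (d : (R.level n).carrier) : R.single n d n = d :=
  lp.single_apply_self (E := fun n => (R.level n).carrier) 2 n d

lemma single_ne {m n : ℕ} (h : m ≠ n) (d : (R.level n).carrier) : R.single n d m = 0 :=
  lp.single_apply_ne (E := fun n => (R.level n).carrier) 2 n d h

/-- The inclusion of the `n`th summand. -/
def inclLevel (n : ℕ) : (R.level n).carrier →L[ℂ] R.DilationSpace :=
  (WithLp.prodContinuousLinearEquiv 2 ℂ H
    (lp (fun n => (R.level n).carrier) 2)).symm.toContinuousLinearMap ∘L
      ContinuousLinearMap.inr ℂ _ _ ∘L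
        lp.singleContinuousLinearMap ℂ (fun n => (R.level n).carrier) 2 n

lemma modelV_incl (x : E) (h : H) :
    R.modelV x (R.incl h) = R.incl (R.T x h) + R.inclLevel 0 (R.defectVec x h) := by
  refine R.dilationSpace_ext (add_zero (R.T x h)).symm fun n => ?_
  change R.modelSeq x h (fun _ => 0) n = 0 + R.single 0 (R.defectVec x h) n
  rw [zero_add]
  cases n with
  | zero => exact (R.single_self 0 (R.defectVec x h)).symm
  | succ n =>
    exact (map_zero (tensL (R.level n).rep x)).trans
      (R.single_ne n.succ_ne_zero (R.defectVec x h)).symm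

lemma modelSeq_single (x : E) (n : ℕ) (d : (R.level n).carrier) :
    ∀ m, R.modelSeq x 0 (fun m => R.single n d m) m
      = R.single (n + 1) (tens (R.level n).rep x d) m
  | 0 => by
    refine Eq.trans (Subtype.ext ?_) (R.single_ne n.succ_ne_zero.symm _).symm
    change R.defectOp (tensL R.σ x 0) = 0
    rw [map_zero, map_zero]
  | m + 1 => by
    change tensL (R.level m).rep x (R.single n d m) = _
    by_cases h : m = n
    · subst h
      rw [R.single_self]
      exact (R.single_self (m + 1) (tens (R.level m).rep x d)).symm
    · rw [R.single_ne h, map_zero]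
      exact (R.single_ne (fun h' => h (Nat.succ.inj h')) (tens (R.level n).rep x d)).symm

lemma modelV_inclLevel (x : E) (n : ℕ) (d : (R.level n).carrier) :
    R.modelV x (R.inclLevel n d) = R.inclLevel (n + 1) (tens (R.level n).rep x d) :=
  R.dilationSpace_ext (map_zero (R.T x)) (R.modelSeq_single x n d)

/-- A closed subspace that contains `H` and is invariant under all `V(x)` is the whole space. -/
lemma eq_top_of_modelV_invariant (M : Submodule ℂ R.DilationSpace)
    (hM : IsClosed (M : Set R.DilationSpace)) (hH : ∀ h, R.incl h ∈ M)
    (hV : ∀ x, ∀ k ∈ M, R.modelV x k ∈ M) : M = ⊤ := by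
  have hlev : ∀ n d, R.inclLevel n d ∈ M := by
    intro n
    induction n with
    | zero =>
      intro (d : R.defectSpace)
      have hcl : IsClosed ((M.comap (R.inclLevel 0).toLinearMap :
          Submodule ℂ R.defectSpace) : Set R.defectSpace) := hM.preimage (R.inclLevel 0).continuous
      have h1 : ∀ z, (⟨R.defectOp z, R.defectOp_mem z⟩ : R.defectSpace) ∈
          (M.comap (R.inclLevel 0).toLinearMap : Submodule ℂ R.defectSpace) := by
        let Δ : Interior E R.σ →L[ℂ] R.defectSpace := R.defectOp.codRestrict _ R.defectOp_mem
        refine mem_of_tens_mem R.σ (M := (M.comap (R.inclLevel 0).toLinearMap).comap Δ.toLinearMap)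
          (hcl.preimage Δ.continuous) fun x h => ?_
        change R.inclLevel 0 (R.defectVec x h) ∈ M
        -- The vector `Δ(x ⊗ h)` equals `V(x)h - T(x)h`, a difference of two vectors of `M`.
        rw [← add_sub_cancel_left (R.incl (R.T x h)) (R.inclLevel 0 (R.defectVec x h)),
          ← modelV_incl]
        exact sub_mem (hV x _ (hH h)) (hH _)
      have h2 : Dense (Set.range fun z => (⟨R.defectOp z, R.defectOp_mem z⟩ : R.defectSpace)) := by
        intro d
        rw [closure_subtype]
        have h3 : (d : Interior E R.σ) ∈ closure (Set.range R.defectOp) := d.2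
        convert h3 using 2
        ext z
        constructor
        · rintro ⟨_, ⟨y, rfl⟩, rfl⟩; exact ⟨y, rfl⟩
        · rintro ⟨y, rfl⟩; exact ⟨_, ⟨y, rfl⟩, rfl⟩
      exact closure_minimal (by rintro _ ⟨z, rfl⟩; exact h1 z) hcl (h2 d)
    | succ n ih =>
      -- `V(x)` carries `d` at level `n` to `x ⊗ d` at level `n + 1`, and such tensors are total
      -- there.
      exact mem_of_tens_mem (R.level n).rep (M := M.comap (R.inclLevel (n + 1)).toLinearMap)
        (hM.preimage (R.inclLevel (n + 1)).continuous) fun x d => by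
          change R.inclLevel (n + 1) (tens (R.level n).rep x d) ∈ M
          rw [← modelV_inclLevel]
          exact hV x _ (ih d)
  rw [eq_top_iff]
  intro k _
  have h1 : k = R.incl k.fst + WithLp.toLp 2 (0, k.snd) :=
    R.dilationSpace_ext (add_zero k.fst).symm fun n => (zero_add (k.snd n)).symm
  rw [h1]
  refine add_mem (hH _) ?_
  let J : lp (fun n => (R.level n).carrier) 2 →L[ℂ] R.DilationSpace :=
    (WithLp.prodContinuousLinearEquiv 2 ℂ H
      (lp (fun n => (R.level n).carrier) 2)).symm.toContinuousLinearMap ∘L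
        ContinuousLinearMap.inr ℂ _ _
  have h2 := (lp.hasSum_single (p := 2) (by norm_num) k.snd).mapL J
  exact hM.mem_of_tendsto h2 (Filter.Eventually.of_forall fun s =>
    Submodule.sum_mem _ fun n _ => hlev n _)

end CCRep

end ModelOperators

/-! ### The defect model as a minimal isometric dilation -/

section ModelDilation

variable {L : Type*} [NormedAddCommGroup L] [InnerProductSpace ℂ L] [CompleteSpace L]
  {N : VonNeumannAlgebra L}
  {E : Type*} [NormedAddCommGroup E] [NormedSpace ℂ E] [Module (Alg N)ᵐᵒᵖ E]
  [CStarCorrespondence (Alg N) E] [IsWStarCorrespondence N E]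
  {H : Type*} [NormedAddCommGroup H] [InnerProductSpace ℂ H] [CompleteSpace H]
  (R : CovRep N E H)

/-- The explicit dilation on `K = H ⊕ 𝒟 ⊕ (E ⊗ 𝒟) ⊕ …`. -/
def CovRep.model : CovRep N E R.DilationSpace :=
  CovRep.ofIsometric R.modelRep
    ((isNormalRep_of_continuous R.normal).prodRep (IsNormalRep.lpRep R.isNormalRep_level))
    R.modelV R.modelV_isometric R.modelV_lact

lemma CovRep.isDefectModel_model : IsDefectModel R R.model where
  rep_fst _ _ := rfl
  rep_snd _ _ _ := rfl
  T_fst _ _ := rfl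
  T_zero _ _ := rfl
  T_succ _ _ _ := rfl

lemma CovRep.isMinimalIsometricDilation_model : IsMinimalIsometricDilation R R.model R.incl where
  isometric := R.modelV_isometric
  proj_comm a := ContinuousLinearMap.ext fun k => by
    have hk : R.incl (R.modelRep a k).fst = R.modelRep a (R.incl k.fst) :=
      R.dilationSpace_ext rfl fun n => (map_zero ((R.level n).rep a)).symm
    exact ((R.projOnto_incl _).trans hk).trans (congrArg (R.modelRep a) (R.projOnto_incl k)).symm
  rep_incl a _ := R.dilationSpace_ext rfl fun n => map_zero ((R.level n).rep a)
  adjoint_invariant x h := ⟨_, R.adjoint_modelV_incl x h⟩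
  compression _ _ := R.projOnto_incl _
  -- Invariance under the operators `V(x)` alone suffices; invariance under `ρ` and the adjoints is
  -- not used.
  minimal M hM hH := R.eq_top_of_modelV_invariant M hM.1 hH fun x k hk => (hM.2.2 x k hk).1

end ModelDilation

/-! ### Words and uniqueness of the minimal isometric dilation -/

section Gram

variable {X : Type*} {K₁ : Type*} [NormedAddCommGroup K₁] [InnerProductSpace ℂ K₁] [CompleteSpace K₁]
  {K₂ : Type*} [NormedAddCommGroup K₂] [InnerProductSpace ℂ K₂] [CompleteSpace K₂]

/-- The right side sees `v` only through its Gram matrix, so families with equal Gram matrices give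
combinations of equal norm. -/
lemma inner_linearCombination {K : Type*} [NormedAddCommGroup K] [InnerProductSpace ℂ K]
    (v : X → K) (c d : X →₀ ℂ) :
    ⟪Finsupp.linearCombination ℂ v c, Finsupp.linearCombination ℂ v d⟫_ℂ
      = d.sum fun j b => b * c.sum fun i a => star a * ⟪v i, v j⟫_ℂ := by
  simp only [Finsupp.linearCombination_apply, Finsupp.sum, sum_inner, inner_sum, inner_smul_left,
    inner_smul_right]
  rfl

lemma denseRange_linearCombination {K : Type*} [NormedAddCommGroup K] [InnerProductSpace ℂ K]
    {v : X → K} (hv : (Submodule.span ℂ (Set.range v)).topologicalClosure = ⊤) :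
    DenseRange (Finsupp.linearCombination ℂ v) := by
  rw [← Finsupp.range_linearCombination] at hv
  rw [DenseRange, ← LinearMap.coe_range]
  exact Submodule.dense_iff_topologicalClosure_eq_top.mpr hv

/-- Two total families with the same Gram matrix are unitarily equivalent. -/
lemma exists_unitary_of_gram (v : X → K₁) (w : X → K₂)
    (hv : (Submodule.span ℂ (Set.range v)).topologicalClosure = ⊤)
    (hw : (Submodule.span ℂ (Set.range w)).topologicalClosure = ⊤)
    (h : ∀ i j, ⟪v i, v j⟫_ℂ = ⟪w i, w j⟫_ℂ) :
    ∃ U : K₁ ≃ₗᵢ[ℂ] K₂, ∀ i, U (v i) = w i := by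
  have hn : ∀ c, ‖Finsupp.linearCombination ℂ w c‖ = ‖Finsupp.linearCombination ℂ v c‖ := by
    intro c
    rw [← sq_eq_sq₀ (norm_nonneg _) (norm_nonneg _), ← inner_self_eq_norm_sq (𝕜 := ℂ),
      ← inner_self_eq_norm_sq (𝕜 := ℂ), inner_linearCombination, inner_linearCombination]
    simp only [h]
  refine ⟨(LinearEquiv.refl ℂ (X →₀ ℂ)).extendOfIsometry (Finsupp.linearCombination ℂ v)
    (Finsupp.linearCombination ℂ w) (denseRange_linearCombination hv) (denseRange_linearCombination hw) hn, fun i => ?_⟩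
  have h1 := LinearEquiv.extendOfIsometry_eq (LinearEquiv.refl ℂ (X →₀ ℂ))
    (Finsupp.linearCombination ℂ v) (Finsupp.linearCombination ℂ w) (denseRange_linearCombination hv) (denseRange_linearCombination hw) hn
    (Finsupp.single i 1)
  simpa using h1

end Gram

/-! ### Words, their Gram matrix, and uniqueness -/

section Words

variable {L : Type*} [NormedAddCommGroup L] [InnerProductSpace ℂ L] [CompleteSpace L]
  {N : VonNeumannAlgebra L}
  {E : Type*} [NormedAddCommGroup E] [NormedSpace ℂ E] [Module (Alg N)ᵐᵒᵖ E]
  [CStarCorrespondence (Alg N) E]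
  {H : Type*} [NormedAddCommGroup H] [InnerProductSpace ℂ H] [CompleteSpace H]
  {K : Type*} [NormedAddCommGroup K] [InnerProductSpace ℂ K] [CompleteSpace K]
  {R : CovRep N E H} {D : CovRep N E K} {ι : H →ₗᵢ[ℂ] K}

namespace IsIsometricDilation

lemma inner_T (hD : IsIsometricDilation R D ι) (x y : E) (k l : K) :
    ⟪D.T x k, D.T y l⟫_ℂ = ⟪k, D.σ (inner (Alg N) x y) l⟫_ℂ := by
  rw [← hD.isometric, ContinuousLinearMap.comp_apply, ContinuousLinearMap.adjoint_inner_right]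

lemma inner_projOnto (ι : H →ₗᵢ[ℂ] K) (k : K) (h : H) : ⟪projOnto ι k, ι h⟫_ℂ = ⟪k, ι h⟫_ℂ := by
  change ⟪ι (adjoint ι.toContinuousLinearMap k), ι h⟫_ℂ = _
  rw [ι.inner_map_map, ContinuousLinearMap.adjoint_inner_left]
  rfl

lemma inner_T_incl (hD : IsIsometricDilation R D ι) (x : E) (h k : H) :
    ⟪D.T x (ι h), ι k⟫_ℂ = ⟪R.T x h, k⟫_ℂ := by
  rw [← inner_projOnto, hD.compression, ι.inner_map_map]

/-- As `V(x)*` leaves `H` invariant, `V(x)* h` is determined by its inner products with `H`, and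
these are given by the compression `T(x)`. -/
lemma adjoint_T_incl (hD : IsIsometricDilation R D ι) (x : E) (h : H) :
    adjoint (D.T x) (ι h) = ι (adjoint (R.T x) h) := by
  obtain ⟨k, hk⟩ := hD.adjoint_invariant x h
  rw [hk]
  congr 1
  refine ext_inner_left ℂ fun k' => ?_
  rw [← ι.inner_map_map, ← hk, ContinuousLinearMap.adjoint_inner_right,
    ContinuousLinearMap.adjoint_inner_right, hD.inner_T_incl]

end IsIsometricDilation

/-- The vector `V(x₁) ⋯ V(xₙ) h`. -/
def CovRep.word (D : CovRep N E K) (ι : H →ₗᵢ[ℂ] K) : List E → H → K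
  | [], h => ι h
  | x :: l, h => D.T x (CovRep.word D ι l h)

/-- The action of `N` on words. -/
def CovRep.actWord (R : CovRep N E H) (a : Alg N) : List E × H → List E × H
  | ([], h) => ([], R.σ a h)
  | (x :: l, h) => (CStarCorrespondence.lact a x :: l, h)

namespace IsIsometricDilation

/-- Covariance lets the first letter absorb `ρ(a)`; for the empty word `ρ(a)` acts on `H` as `σ(a)`.
Words go to words by a rule independent of the dilation. -/
lemma rep_word (hD : IsIsometricDilation R D ι) (a : Alg N) (l : List E) (h : H) :
    D.σ a (D.word ι l h) = D.word ι (R.actWord a (l, h)).1 (R.actWord a (l, h)).2 := by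
  cases l with
  | nil => exact hD.rep_incl a h
  | cons x l => exact (congrArg (fun S => S (D.word ι l h)) (D.map_lact a x)).symm

/-- Every inner product of words reduces to `(T, σ)`. Against the empty word, the letters of the
other are moved one by one onto `H` as operators `T(y)*`. If both words have a first letter, `V(x)*
V(y) = ρ(⟨x, y⟩)` removes both and is absorbed by what remains. -/
lemma inner_word {K' : Type*} [NormedAddCommGroup K'] [InnerProductSpace ℂ K'] [CompleteSpace K']
    {D' : CovRep N E K'} {ι' : H →ₗᵢ[ℂ] K'}
    (hD : IsIsometricDilation R D ι) (hD' : IsIsometricDilation R D' ι') (l m : List E) (h k : H) :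
    ⟪D.word ι l h, D.word ι m k⟫_ℂ = ⟪D'.word ι' l h, D'.word ι' m k⟫_ℂ := by
  have hnil : ∀ (m : List E) (h k : H),
      ⟪ι h, D.word ι m k⟫_ℂ = ⟪ι' h, D'.word ι' m k⟫_ℂ := by
    intro m
    induction m with
    | nil =>
      intro h k
      exact (ι.inner_map_map h k).trans (ι'.inner_map_map h k).symm
    | cons y m ih =>
      intro h k
      change ⟪ι h, D.T y (D.word ι m k)⟫_ℂ = ⟪ι' h, D'.T y (D'.word ι' m k)⟫_ℂ
      rw [← ContinuousLinearMap.adjoint_inner_left, ← ContinuousLinearMap.adjoint_inner_left,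
        hD.adjoint_T_incl, hD'.adjoint_T_incl, ih]
  -- Absorbing `ρ(⟨x, y⟩)` changes the second word or its vector, so both must remain arbitrary in
  -- the induction.
  induction l generalizing h m k with
  | nil => exact hnil m h k
  | cons x l ih =>
    cases m with
    | nil =>
      rw [← inner_conj_symm, ← inner_conj_symm (D'.word ι' (x :: l) h)]
      exact congrArg _ (hnil (x :: l) k h)
    | cons y m =>
      change ⟪D.T x (D.word ι l h), D.T y (D.word ι m k)⟫_ℂ
        = ⟪D'.T x (D'.word ι' l h), D'.T y (D'.word ι' m k)⟫_ℂ
      rw [hD.inner_T, hD'.inner_T, hD.rep_word, hD'.rep_word, ih]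

end IsIsometricDilation

namespace IsMinimalIsometricDilation

/-- The closed span of the words contains `H` and reduces `(V, ρ)`: `V(x)` adds a letter, `ρ(a)` is
absorbed, and `V(x)*` either replaces a first letter `y` by `ρ(⟨x, y⟩)` or acts on `H` as `T(x)*`.
-/
lemma span_word_dense (hD : IsMinimalIsometricDilation R D ι) : (Submodule.span ℂ
    (Set.range fun p : List E × H => D.word ι p.1 p.2)).topologicalClosure = ⊤ := by
  have hmem : ∀ l h, D.word ι l h ∈ (Submodule.span ℂ
      (Set.range fun p : List E × H => D.word ι p.1 p.2)).topologicalClosure :=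
    fun l h => Submodule.le_topologicalClosure _ (Submodule.subset_span ⟨(l, h), rfl⟩)
  have hinv : ∀ S : K →L[ℂ] K, (∀ l h, S (D.word ι l h) ∈ (Submodule.span ℂ
      (Set.range fun p : List E × H => D.word ι p.1 p.2)).topologicalClosure) →
      ∀ k ∈ (Submodule.span ℂ
        (Set.range fun p : List E × H => D.word ι p.1 p.2)).topologicalClosure,
      S k ∈ (Submodule.span ℂ
        (Set.range fun p : List E × H => D.word ι p.1 p.2)).topologicalClosure := by
    intro S hS k hk
    exact Submodule.topologicalClosure_minimal _
      (t := (Submodule.span ℂ (Set.range fun p : List E × H =>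
        D.word ι p.1 p.2)).topologicalClosure.comap S.toLinearMap)
      (Submodule.span_le.mpr (by rintro _ ⟨p, rfl⟩; exact hS p.1 p.2))
      ((Submodule.isClosed_topologicalClosure _).preimage S.continuous) hk
  refine hD.minimal _ ⟨Submodule.isClosed_topologicalClosure _, fun a => hinv _ fun l h => ?_,
    fun x k hk => ⟨hinv _ (fun l h => hmem (x :: l) h) k hk, hinv _ (fun l h => ?_) k hk⟩⟩
    fun h => hmem [] h
  · rw [hD.rep_word]; exact hmem _ _
  · cases l with
    | nil =>
      change adjoint (D.T x) (ι h) ∈ _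
      rw [hD.adjoint_T_incl]; exact hmem [] _
    | cons y l =>
      have h1 : adjoint (D.T x) (D.word ι (y :: l) h) = D.σ (inner (Alg N) x y) (D.word ι l h) :=
        congrArg (fun S => S (D.word ι l h)) (hD.isometric x y)
      rw [h1, hD.rep_word]; exact hmem _ _

/-- Bounded operators that agree on words are equal. -/
lemma ext_word (hD : IsMinimalIsometricDilation R D ι) {X : Type*} [NormedAddCommGroup X]
    [NormedSpace ℂ X] {S S' : K →L[ℂ] X} (h : ∀ l k, S (D.word ι l k) = S' (D.word ι l k)) :
    S = S' := by
  refine ContinuousLinearMap.ext fun k => ?_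
  have h1 := Submodule.topologicalClosure_minimal
    (Submodule.span ℂ (Set.range fun p : List E × H => D.word ι p.1 p.2))
    (t := LinearMap.eqLocus S.toLinearMap S'.toLinearMap)
    (Submodule.span_le.mpr (by rintro _ ⟨p, rfl⟩; exact h p.1 p.2))
    (isClosed_eq S.continuous S'.continuous)
  rw [hD.span_word_dense] at h1
  exact h1 (Submodule.mem_top (x := k))

/-- Words in the two dilations have the same Gram matrix and are total, which gives `U`. Both `ρ(a)`
and `V(x)` send words to words by the same rules in each dilation, so the intertwining relations
need only be compared on words. -/
theorem exists_unitary {K' : Type*} [NormedAddCommGroup K'] [InnerProductSpace ℂ K']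
    [CompleteSpace K'] {D' : CovRep N E K'} {ι' : H →ₗᵢ[ℂ] K'}
    (hD : IsMinimalIsometricDilation R D ι) (hD' : IsMinimalIsometricDilation R D' ι') :
    ∃ U : K ≃ₗᵢ[ℂ] K', (∀ h : H, U (ι h) = ι' h) ∧
      (∀ (a : Alg N) (k : K), U (D.σ a k) = D'.σ a (U k)) ∧
      (∀ (x : E) (k : K), U (D.T x k) = D'.T x (U k)) := by
  obtain ⟨U, hU⟩ := exists_unitary_of_gram _ _ hD.span_word_dense hD'.span_word_dense
    fun p q : List E × H => hD.inner_word hD'.toIsIsometricDilation p.1 q.1 p.2 q.2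
  have hU' : ∀ l h, U (D.word ι l h) = D'.word ι' l h := fun l h => hU (l, h)
  refine ⟨U, hU' [], fun a k => ?_, fun x k => ?_⟩
  · have h1 : U.toContinuousLinearEquiv.toContinuousLinearMap ∘L D.σ a
        = D'.σ a ∘L U.toContinuousLinearEquiv.toContinuousLinearMap := hD.ext_word fun l h => by
      change U (D.σ a (D.word ι l h)) = D'.σ a (U (D.word ι l h))
      rw [hD.rep_word, hU', hU', hD'.rep_word]
    exact congrArg (fun S => S k) h1
  · have h1 : U.toContinuousLinearEquiv.toContinuousLinearMap ∘L D.T x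
        = D'.T x ∘L U.toContinuousLinearEquiv.toContinuousLinearMap := hD.ext_word fun l h => by
      change U (D.T x (D.word ι l h)) = D'.T x (U (D.word ι l h))
      rw [hU']
      exact hU' (x :: l) h
    exact congrArg (fun S => S k) h1

end IsMinimalIsometricDilation

end Words

/-! ### Fully coisometric representations -/

section Coisometric

variable {L : Type*} [NormedAddCommGroup L] [InnerProductSpace ℂ L] [CompleteSpace L]
  {N : VonNeumannAlgebra L}
  {E : Type*} [NormedAddCommGroup E] [NormedSpace ℂ E] [Module (Alg N)ᵐᵒᵖ E]
  [CStarCorrespondence (Alg N) E]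
  {H : Type*} [NormedAddCommGroup H] [InnerProductSpace ℂ H] [CompleteSpace H]
  {K : Type*} [NormedAddCommGroup K] [InnerProductSpace ℂ K] [CompleteSpace K]
  {R : CovRep N E H} {D : CovRep N E K} {ι : H →ₗᵢ[ℂ] K}

lemma eq_of_inner_tens (σ : Alg N →⋆ₙₐ[ℂ] (H →L[ℂ] H)) {z w : Interior E σ}
    (h : ∀ x k, ⟪tens σ x k, z⟫_ℂ = ⟪tens σ x k, w⟫_ℂ) : z = w := by
  have h1 := mem_of_tens_mem σ (M := (ℂ ∙ (z - w))ᗮ) (Submodule.isClosed_orthogonal _)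
    (fun x k => Submodule.mem_orthogonal_singleton_iff_inner_left.mpr (by
      rw [inner_sub_right, h, sub_self])) (z - w)
  exact sub_eq_zero.mp (inner_self_eq_zero.mp
    (Submodule.mem_orthogonal_singleton_iff_inner_left.mp h1))

/-- Isometry of the representation makes `Ṽ` preserve inner products of elementary tensors.
Consequently `Ṽ Ṽ*` fixes every `V(x) k`. -/
lemma CovRep.IsIsometric.adjoint_tilde_tilde (hD : D.IsIsometric) (z : Interior E D.σ) :
    adjoint D.tilde (D.tilde z) = z := by
  refine mem_of_tens_mem D.σ
    (M := LinearMap.eqLocus (adjoint D.tilde ∘L D.tilde).toLinearMap LinearMap.id)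
    (isClosed_eq (adjoint D.tilde ∘L D.tilde).continuous continuous_id) (fun y l => ?_) z
  refine eq_of_inner_tens D.σ fun x k => ?_
  change ⟪tens D.σ x k, adjoint D.tilde (D.tilde (tens D.σ y l))⟫_ℂ = ⟪tens D.σ x k, tens D.σ y l⟫_ℂ
  rw [ContinuousLinearMap.adjoint_inner_right, D.tilde_tens, D.tilde_tens, inner_tens, ← hD,
    ContinuousLinearMap.comp_apply, ContinuousLinearMap.adjoint_inner_right]

lemma norm_sub_eq_of_inner_eq {G : Type*} [NormedAddCommGroup G] [InnerProductSpace ℂ G]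
    {a b : K} {c d : G} (h1 : ⟪a, a⟫_ℂ = ⟪c, c⟫_ℂ) (h2 : ⟪b, b⟫_ℂ = ⟪d, d⟫_ℂ)
    (h3 : ⟪a, b⟫_ℂ = ⟪c, d⟫_ℂ) : ‖a - b‖ = ‖c - d‖ := by
  have h4 : ⟪b, a⟫_ℂ = ⟪d, c⟫_ℂ := by rw [← inner_conj_symm, h3, inner_conj_symm]
  rw [← sq_eq_sq₀ (norm_nonneg _) (norm_nonneg _), ← inner_self_eq_norm_sq (𝕜 := ℂ),
    ← inner_self_eq_norm_sq (𝕜 := ℂ)]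
  simp only [inner_sub_left, inner_sub_right, h1, h2, h3, h4]

variable (D ι) in
/-- The map `x ⊗ h ↦ V(x) h` on the algebraic tensor product. -/
def CovRep.preRestrict (σ : Alg N →⋆ₙₐ[ℂ] (H →L[ℂ] H)) : PreInterior E σ →ₗ[ℂ] K :=
  TensorProduct.lift (LinearMap.compl₂ (ContinuousLinearMap.coeLM ℂ ∘ₗ D.T) ι.toLinearMap)

lemma CovRep.preRestrict_tens (σ : Alg N →⋆ₙₐ[ℂ] (H →L[ℂ] H)) (x : E) (h : H) :
    D.preRestrict ι σ (preTens σ x h) = D.T x (ι h) := rfl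

namespace IsIsometricDilation

lemma inner_preRestrict (hD : IsIsometricDilation R D ι) (z w : PreInterior E R.σ) :
    ⟪D.preRestrict ι R.σ z, D.preRestrict ι R.σ w⟫_ℂ = ⟪z, w⟫_ℂ := by
  induction z using preInterior_induction with
  | h0 => simp
  | ht x h =>
    induction w using preInterior_induction with
    | h0 => simp
    | ht y k =>
      rw [CovRep.preRestrict_tens, CovRep.preRestrict_tens, hD.inner_T, preInner_tens,
        hD.rep_incl, ι.inner_map_map]
    | ha z w hz hw => simp only [map_add, inner_add_right, hz, hw]
  | ha z w hz hw => simp only [map_add, inner_add_left, hz, hw]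

lemma inner_preRestrict_incl (hD : IsIsometricDilation R D ι) (z : PreInterior E R.σ) (h : H) :
    ⟪D.preRestrict ι R.σ z, ι h⟫_ℂ = ⟪(z : Interior E R.σ), adjoint R.tilde h⟫_ℂ := by
  rw [ContinuousLinearMap.adjoint_inner_right]
  induction z using preInterior_induction with
  | h0 => rw [map_zero, UniformSpace.Completion.coe_zero, map_zero, inner_zero_left, inner_zero_left]
  | ht x k =>
    have h1 : R.tilde (preTens R.σ x k : Interior E R.σ) = R.T x k := R.tilde_tens x k
    rw [h1, CovRep.preRestrict_tens, hD.inner_T_incl]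
  | ha z w hz hw =>
    rw [map_add, UniformSpace.Completion.coe_add, map_add, inner_add_left, inner_add_left, hz, hw]

/-- Approximate `T̃* h` by an algebraic tensor `z`, and let `v` be the image of `z` under `x ⊗ k ↦
V(x) k`. Then `‖v‖ = ‖z‖`, `⟪v, h⟫ = ⟪z, T̃* h⟫` and, by full coisometry, `‖h‖ = ‖T̃* h‖`. Hence `‖v
- h‖ = ‖z - T̃* h‖`. -/
lemma incl_mem_closure (hD : IsIsometricDilation R D ι) (hR : R.IsFullyCoisometric) (h : H) :
    ι h ∈ closure (Set.range (D.preRestrict ι R.σ)) := by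
  have h0 : R.tilde (adjoint R.tilde h) = h := congrArg (fun S => S h) hR
  refine Metric.mem_closure_iff.mpr fun ε hε => ?_
  obtain ⟨z, hz⟩ := (UniformSpace.Completion.denseRange_coe
    (α := PreInterior E R.σ)).exists_dist_lt (adjoint R.tilde h) hε
  refine ⟨D.preRestrict ι R.σ z, Set.mem_range_self z, ?_⟩
  rw [dist_comm, dist_eq_norm] at hz ⊢
  refine (norm_sub_eq_of_inner_eq ?_ ?_ (hD.inner_preRestrict_incl z h)).trans_lt hz
  · exact (hD.inner_preRestrict z z).trans (UniformSpace.Completion.inner_coe z z).symm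
  · rw [ContinuousLinearMap.adjoint_inner_left, h0]
    exact ι.inner_map_map h h

end IsIsometricDilation

/-- `Ṽ Ṽ*` fixes each `V(x) k`, hence all words of positive length. It fixes `H` as well, since `H`
lies in the closure of the span of vectors `V(x) k`. Words are total, so it is the identity. -/
theorem IsMinimalIsometricDilation.isFullyCoisometric (hD : IsMinimalIsometricDilation R D ι)
    (hR : R.IsFullyCoisometric) : D.IsFullyCoisometric := by
  have hT : ∀ x k, (D.tilde ∘L adjoint D.tilde) (D.T x k) = D.T x k := fun x k => by
    rw [← D.tilde_tens, ContinuousLinearMap.comp_apply, hD.isometric.adjoint_tilde_tilde]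
  refine hD.ext_word fun l h => ?_
  cases l with
  | cons x l => exact hT x _
  | nil =>
    refine closure_minimal (t := {k | (D.tilde ∘L adjoint D.tilde) k = k}) ?_
      (isClosed_eq (D.tilde ∘L adjoint D.tilde).continuous continuous_id)
      (hD.incl_mem_closure hR h)
    rintro _ ⟨z, rfl⟩
    induction z using preInterior_induction with
    | h0 => rw [map_zero]; exact map_zero _
    | ht x k => exact hT x _
    | ha z w hz hw =>
      rw [map_add]
      exact (map_add (D.tilde ∘L adjoint D.tilde) _ _).trans (congrArg₂ (· + ·) hz hw)

end Coisometric

end WCorr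

end

theorem theorem1p13
    {L : Type*} [NormedAddCommGroup L] [InnerProductSpace ℂ L] [CompleteSpace L]
    (N : VonNeumannAlgebra L)
    {E : Type*} [NormedAddCommGroup E] [NormedSpace ℂ E] [Module (WCorr.Alg N)ᵐᵒᵖ E]
    [WCorr.CStarCorrespondence (WCorr.Alg N) E] [WCorr.IsWStarCorrespondence N E]
    {H : Type*} [NormedAddCommGroup H] [InnerProductSpace ℂ H] [CompleteSpace H]
    (R : WCorr.CovRep N E H) :
    -- the explicit minimal isometric dilation
    (∃ D : WCorr.CovRep N E R.DilationSpace,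
      WCorr.IsDefectModel R D ∧ WCorr.IsMinimalIsometricDilation R D R.incl ∧
      ((∀ x : E, WCorr.CStarCorrespondence.lact (1 : WCorr.Alg N) x = x) →
        R.σ 1 = ContinuousLinearMap.id ℂ H →
        D.σ 1 = ContinuousLinearMap.id ℂ R.DilationSpace)) ∧
    -- uniqueness of the minimal isometric dilation up to unitary equivalence
    (∀ (K₁ : Type*) [NormedAddCommGroup K₁] [InnerProductSpace ℂ K₁] [CompleteSpace K₁]
      (K₂ : Type*) [NormedAddCommGroup K₂] [InnerProductSpace ℂ K₂] [CompleteSpace K₂]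
      (ι₁ : H →ₗᵢ[ℂ] K₁) (ι₂ : H →ₗᵢ[ℂ] K₂)
      (D₁ : WCorr.CovRep N E K₁) (D₂ : WCorr.CovRep N E K₂),
      WCorr.IsMinimalIsometricDilation R D₁ ι₁ → WCorr.IsMinimalIsometricDilation R D₂ ι₂ →
      ∃ U : K₁ ≃ₗᵢ[ℂ] K₂, (∀ h : H, U (ι₁ h) = ι₂ h) ∧
        (∀ (a : WCorr.Alg N) (k : K₁), U (D₁.σ a k) = D₂.σ a (U k)) ∧
        (∀ (x : E) (k : K₁), U (D₁.T x k) = D₂.T x (U k))) ∧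
    -- the minimal isometric dilation is fully coisometric when the given representation is
    (R.IsFullyCoisometric →
      ∀ (K : Type*) [NormedAddCommGroup K] [InnerProductSpace ℂ K] [CompleteSpace K]
        (ι : H →ₗᵢ[ℂ] K) (D : WCorr.CovRep N E K),
        WCorr.IsMinimalIsometricDilation R D ι → D.IsFullyCoisometric) :=
  ⟨⟨R.model, R.isDefectModel_model, R.isMinimalIsometricDilation_model, R.modelRep_one⟩,
    fun _ _ _ _ _ _ _ _ _ _ _ _ h₁ h₂ => h₁.exists_unitary h₂,
    fun hR _ _ _ _ _ _ hD => hD.isFullyCoisometric hR⟩
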